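/- Let $\Phi=|\Phi\rangle\langle\Phi|$ with $|\Phi\rangle=\frac{1}{\sqrt2}(|00\rangle+|11\rangle)$, and for $\rho\in(0,1)$ let $\Delta_\rho(\Phi)=\rho\,\Phi+(1-\rho)\frac{I}{4}$. For every $\rho_0>0$ there is a constant $C>0$, depending only on $\rho_0$, such that the following holds for all $\rho\in(0,1)$ with $\rho\ge\rho_0$ and all $n\ge 1$. Suppose that Alice and Bob share $(\Delta_\rho(\Phi))^{\otimes n}$ and that, on question $x\in\{0,1\}$ (respectively $y\in\{0,1\}$) of the CHSH game, Alice (respectively Bob) measures her (his) $n$ qubits with a POVM with outcomes in $\{1,-1\}$; let $P_x=E^x_{1}-E^x_{-1}$ and $Q_y=F^y_{1}-F^y_{-1}$ be the corresponding observables. Let $t\ge 1$ be an integer, $p>0$, $\delta=\big(\frac{2\ln(2/p)}{t}\big)^{1/2}$ and $\epsilon_v\ge 0$, and assume: 1. (Trace test.) Independent, identically distributed rounds are played, each with a fresh copy of the shared state and with a uniformly random pair of questions, until each player has received each question at least $t$ times. The test is passed if, for every player $D\in\{A,B\}$, every question $x$ and every answer $a$, the frequency $\hat p_D(a|x)$ of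 the answer $a$ among the first $t$ rounds in which $D$ received $x$ satisfies $|\hat p_D(a|x)-\frac12|<\delta$. The players pass with probability at least $p$. 2. (Violation.) $\mathrm{Tr}\big((P_0\otimes Q_0+P_0\otimes Q_1+P_1\otimes Q_0-P_1\otimes Q_1)\,(\Delta_\rho(\Phi))^{\otimes n}\big)\ \ge\ 2\sqrt2\,\rho-\epsilon_v$. Put $\gamma=\frac{1}{1-\rho}$ and $\epsilon=\epsilon_v+9\delta^2$, and for $2^n\times2^n$ matrices write $A\approx B$ if $2^{-n/2}\|A-B\|_F\le C\,\gamma\sqrt{\epsilon}$. Then there is a register $k\in\{1,\dots,n\}$ such that: * for each $D\in\{P,Q\}$ and $j\in\{0,1\}$ there is a $2\times 2$ Hermitian matrix $\tilde D_j$ with $\tilde D_j^2=I$ and $\mathrm{Tr}\,\tilde D_j=0$ such that $D_j\approx \tilde D_j^{(k)}\otimes I^{[n]\setminus\{k\}}$; * there are $2\times2$ unitaries $\tilde U_A,\tilde U_B$ such that, with $U_A=\tilde U_A^{(k)}\otimes I^{[n]\setminus\{k\}}$ and $U_B=\tilde U_B^{(k)}\otimes I^{[n]\setminus\{k\}}$,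 $$U_AP_0U_A^*\approx Z^{(k)}\otimes I^{[n]\setminus\{k\}},\quad U_AP_1U_A^*\approx X^{(k)}\otimes I^{[n]\setminus\{k\}},\quad U_BQ_0U_B^*\approx Z^{(k)}\otimes I^{[n]\setminus\{k\}},\quad U_BQ_1U_B^*\approx X^{(k)}\otimes I^{[n]\setminus\{k\}}.$$ -/

import Mathlib

open MeasureTheory
open scoped Kronecker ComplexOrder MatrixOrder

noncomputable section

namespace NoisyCHSH

/-! ### Matrices on a register of `n` qubits

The space `(ℂ²)^{⊗n}` has the computational basis indexed by `Fin n → Fin 2`. -/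

/-- The `n`-fold tensor product `M 0 ⊗ ⋯ ⊗ M (n-1)` of square matrices indexed by `ι`. -/
def tensor {n : ℕ} {ι : Type} (M : Fin n → Matrix ι ι ℂ) :
    Matrix (Fin n → ι) (Fin n → ι) ℂ :=
  Matrix.of fun x y => ∏ i, M i (x i) (y i)

/-- `M^{(k)} ⊗ I^{[n] ∖ {k}}`: the one-qubit matrix `M` acts on the register `k`,
and the identity on all the other registers. -/
def onRegister {n : ℕ} (k : Fin n) (M : Matrix (Fin 2) (Fin 2) ℂ) :
    Matrix (Fin n → Fin 2) (Fin n → Fin 2) ℂ :=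
  tensor (Function.update (fun _ => 1) k M)

/-- The normalized Frobenius norm `d^{-1/2} ‖M‖_F = (d⁻¹ Tr (M M^*))^{1/2}`. -/
def normF {ι : Type} [Fintype ι] (M : Matrix ι ι ℂ) : ℝ :=
  Real.sqrt ((M * M.conjTranspose).trace.re / Fintype.card ι)

def pauliX : Matrix (Fin 2) (Fin 2) ℂ := !![0, 1; 1, 0]

def pauliZ : Matrix (Fin 2) (Fin 2) ℂ := !![1, 0; 0, -1]

/-- A traceless binary (i.e. `±1`-valued) observable on one qubit. -/
structure IsTracelessObservable (M : Matrix (Fin 2) (Fin 2) ℂ) : Prop where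
  isHermitian : M.IsHermitian
  sq_eq_one : M * M = 1
  trace_eq_zero : M.trace = 0

theorem tensor_mul {n : ℕ} {ι : Type} [Fintype ι] (M N : Fin n → Matrix ι ι ℂ) :
    tensor M * tensor N = tensor fun i => M i * N i := by
  classical
  ext x y
  simp only [tensor, Matrix.mul_apply, Matrix.of_apply, ← Finset.prod_mul_distrib]
  rw [Finset.prod_univ_sum]
  simp [Fintype.piFinset_univ]

theorem conjTranspose_tensor {n : ℕ} {ι : Type} (M : Fin n → Matrix ι ι ℂ) :
    (tensor M).conjTranspose = tensor fun i => (M i).conjTranspose := by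
  ext x y
  simp [tensor, Matrix.conjTranspose_apply]

theorem trace_tensor {n : ℕ} {ι : Type} [Fintype ι] (M : Fin n → Matrix ι ι ℂ) :
    (tensor M).trace = ∏ i, (M i).trace := by
  classical
  simp only [Matrix.trace, Matrix.diag, tensor, Matrix.of_apply]
  rw [Finset.prod_univ_sum]
  simp [Fintype.piFinset_univ]

theorem posSemidef_tensor {n : ℕ} {ι : Type} [Fintype ι] {M : Fin n → Matrix ι ι ℂ}
    (hM : ∀ i, (M i).PosSemidef) : (tensor M).PosSemidef := by
  classical
  have h : ∀ i, ∃ B : Matrix ι ι ℂ, M i = B.conjTranspose * B := fun i => by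
    have := (hM i).nonneg
    exact CStarAlgebra.nonneg_iff_eq_star_mul_self.mp this
  choose B hB using h
  have : tensor M = (tensor B).conjTranspose * tensor B := by
    rw [conjTranspose_tensor, tensor_mul]
    exact congrArg tensor (funext hB)
  rw [this]
  exact Matrix.posSemidef_conjTranspose_mul_self _

/-! ### States, measurements and strategies -/

/-- A density matrix: positive semidefinite with unit trace. -/
structure DensityMatrix (ι : Type) [Fintype ι] where
  mat : Matrix ι ι ℂ
  posSemidef : mat.PosSemidef
  trace_eq_one : mat.trace = 1

/-- The depolarizing channel `Δ_ρ(M) = ρ M + (1 - ρ) (Tr M) I / m`, with `m` the dimension. -/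
def depolarize {ι : Type} [Fintype ι] [DecidableEq ι] (ρ : ℝ) (M : Matrix ι ι ℂ) :
    Matrix ι ι ℂ :=
  (ρ : ℂ) • M + ((1 - ρ : ℂ) * M.trace / (Fintype.card ι : ℂ)) • (1 : Matrix ι ι ℂ)

/-- The vector `|Φ⟩ = (|00⟩ + |11⟩) / √2`. -/
def eprVec : Fin 2 × Fin 2 → ℂ := fun s => if s.1 = s.2 then ((Real.sqrt 2)⁻¹ : ℂ) else 0

/-- The EPR state `Φ = |Φ⟩⟨Φ|`. -/
def epr : Matrix (Fin 2 × Fin 2) (Fin 2 × Fin 2) ℂ := Matrix.vecMulVec eprVec (star eprVec)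

/-- The `n`-fold tensor power of a two-qubit matrix, with Alice's `n` qubits collected in the
first tensor factor and Bob's `n` qubits in the second. -/
def bipartitePower (n : ℕ) (φ : Matrix (Fin 2 × Fin 2) (Fin 2 × Fin 2) ℂ) :
    Matrix ((Fin n → Fin 2) × (Fin n → Fin 2)) ((Fin n → Fin 2) × (Fin n → Fin 2)) ℂ :=
  (tensor fun _ : Fin n => φ).submatrix
    (Equiv.arrowProdEquivProdArrow (Fin n) (fun _ => Fin 2) (fun _ => Fin 2)).symm
    (Equiv.arrowProdEquivProdArrow (Fin n) (fun _ => Fin 2) (fun _ => Fin 2)).symm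

theorem trace_epr : epr.trace = 1 := by
  have h : ((Real.sqrt 2 : ℝ) : ℂ) ^ 2 = 2 := by
    rw [← Complex.ofReal_pow, Real.sq_sqrt (by norm_num)]
    norm_num
  simp [epr, eprVec, Matrix.trace, Matrix.vecMulVec_apply, Fintype.sum_prod_type,
    ← sq, h]

theorem posSemidef_depolarize_epr {ρ : ℝ} (h0 : 0 ≤ ρ) (h1 : ρ ≤ 1) :
    (depolarize ρ epr).PosSemidef := by
  unfold depolarize
  rw [trace_epr]
  refine Matrix.PosSemidef.add ?_ ?_
  · refine Matrix.PosSemidef.smul (Matrix.posSemidef_vecMulVec_self_star _) ?_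
    exact_mod_cast h0
  · refine Matrix.PosSemidef.smul Matrix.PosSemidef.one ?_
    have : (0 : ℝ) ≤ (1 - ρ) * 1 / (Fintype.card (Fin 2 × Fin 2) : ℝ) :=
      div_nonneg (by linarith) (by positivity)
    exact_mod_cast this

theorem trace_depolarize_epr (ρ : ℝ) : (depolarize ρ epr).trace = 1 := by
  simp [depolarize, trace_epr]

/-- The state `(Δ_ρ(Φ))^{⊗n}`. -/
def noisyEPR (n : ℕ) (ρ : ℝ) (h0 : 0 ≤ ρ) (h1 : ρ ≤ 1) :
    DensityMatrix ((Fin n → Fin 2) × (Fin n → Fin 2)) where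
  mat := bipartitePower n (depolarize ρ epr)
  posSemidef := (posSemidef_tensor fun _ => posSemidef_depolarize_epr h0 h1).submatrix _
  trace_eq_one := by
    unfold bipartitePower
    rw [Matrix.trace, ← Equiv.sum_comp
      (Equiv.arrowProdEquivProdArrow (Fin n) (fun _ => Fin 2) (fun _ => Fin 2))]
    simp only [Matrix.diag, Matrix.submatrix_apply, Equiv.symm_apply_apply]
    have h := trace_tensor fun _ : Fin n => depolarize ρ epr
    simpa [Matrix.trace, Matrix.diag, trace_depolarize_epr] using h.trans
      (by simp [trace_depolarize_epr])

/-- The answers `1` and `-1`. They are labelled by `true` and `false`. -/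
abbrev Answer := Bool

/-- The numerical value `±1` of an answer. -/
def Answer.value : Answer → ℂ
  | true => 1
  | false => -1

/-- A POVM whose outcomes are the answers `1, -1`. -/
structure POVM (ι : Type) [Fintype ι] [DecidableEq ι] where
  effect : Answer → Matrix ι ι ℂ
  posSemidef : ∀ a, (effect a).PosSemidef
  sum_eq_one : ∑ a, effect a = 1

/-- The observable `∑ a, a E_a` of a POVM. -/
def POVM.observable {ι : Type} [Fintype ι] [DecidableEq ι] (E : POVM ι) : Matrix ι ι ℂ :=
  ∑ a : Answer, Answer.value a • E.effect a

inductive Player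
  | alice
  | bob

/-- A strategy for the CHSH game on `n` shared two-qubit states: for each player and each
question, a POVM on the `n` qubits of that player. -/
abbrev Strategy (n : ℕ) := Player → Fin 2 → POVM (Fin n → Fin 2)

/-- The observable of player `D` for question `x`: `P_x` for Alice and `Q_x` for Bob. -/
def Strategy.obs {n : ℕ} (S : Strategy n) (D : Player) (x : Fin 2) :
    Matrix (Fin n → Fin 2) (Fin n → Fin 2) ℂ :=
  (S D x).observable

/-- The CHSH violation
`Tr ((P₀ ⊗ Q₀ + P₀ ⊗ Q₁ + P₁ ⊗ Q₀ - P₁ ⊗ Q₁) φ)`. -/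
def Strategy.violation {n : ℕ} (S : Strategy n)
    (φ : DensityMatrix ((Fin n → Fin 2) × (Fin n → Fin 2))) : ℝ :=
  ((S.obs .alice 0 ⊗ₖ S.obs .bob 0 + S.obs .alice 0 ⊗ₖ S.obs .bob 1
    + S.obs .alice 1 ⊗ₖ S.obs .bob 0 - S.obs .alice 1 ⊗ₖ S.obs .bob 1) * φ.mat).trace.re

/-! ### The repeated game and the trace test -/

/-- The transcript `((x, y), (a, b))` of one round of the CHSH game:
the questions to Alice and Bob, and their answers. -/
abbrev Round := (Fin 2 × Fin 2) × (Answer × Answer)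

def Round.question (r : Round) : Player → Fin 2
  | .alice => r.1.1
  | .bob => r.1.2

def Round.answer (r : Round) : Player → Answer
  | .alice => r.2.1
  | .bob => r.2.2

/-- The probability of a transcript: the questions are uniform, and the answers follow
the Born rule `Tr ((A^x_a ⊗ B^y_b) φ)`. -/
def Strategy.roundProb {n : ℕ} (S : Strategy n)
    (φ : DensityMatrix ((Fin n → Fin 2) × (Fin n → Fin 2))) (r : Round) : ℝ :=
  1 / 4 * (((S .alice r.1.1).effect r.2.1 ⊗ₖ (S .bob r.1.2).effect r.2.2) * φ.mat).trace.re

theorem trace_mul_re_nonneg {ι : Type} [Fintype ι] {A B : Matrix ι ι ℂ}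
    (hA : A.PosSemidef) (hB : B.PosSemidef) : 0 ≤ (A * B).trace.re := by
  classical
  obtain ⟨C, hC⟩ := CStarAlgebra.nonneg_iff_eq_star_mul_self.mp hA.nonneg
  have h : (A * B).trace = (C * B * C.conjTranspose).trace := by
    rw [hC, Matrix.star_eq_conjTranspose, Matrix.mul_assoc, Matrix.trace_mul_comm]
  rw [h]
  exact (Complex.nonneg_iff.mp (hB.mul_mul_conjTranspose_same C).trace_nonneg).1

theorem Strategy.roundProb_nonneg {n : ℕ} (S : Strategy n)
    (φ : DensityMatrix ((Fin n → Fin 2) × (Fin n → Fin 2))) (r : Round) :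
    0 ≤ S.roundProb φ r :=
  mul_nonneg (by norm_num) (trace_mul_re_nonneg
    (((S .alice r.1.1).posSemidef r.2.1).kronecker ((S .bob r.1.2).posSemidef r.2.2))
    φ.posSemidef)

theorem Strategy.sum_roundProb {n : ℕ} (S : Strategy n)
    (φ : DensityMatrix ((Fin n → Fin 2) × (Fin n → Fin 2))) :
    ∑ r, S.roundProb φ r = 1 := by
  have key : ∀ x y : Fin 2, ∑ a, ∑ b,
      (((S .alice x).effect a ⊗ₖ (S .bob y).effect b) * φ.mat).trace.re = 1 := fun x y => by
    have h1 : ∑ a, ∑ b, ((S .alice x).effect a ⊗ₖ (S .bob y).effect b) = 1 := by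
      ext ⟨i, j⟩ ⟨i', j'⟩
      have hA := congrFun (congrFun (S .alice x).sum_eq_one i) i'
      have hB := congrFun (congrFun (S .bob y).sum_eq_one j) j'
      simp only [Matrix.sum_apply] at hA hB
      simp only [Matrix.sum_apply, Matrix.kroneckerMap_apply]
      rw [← Finset.sum_mul_sum, hA, hB]
      simp [Matrix.one_apply, Prod.ext_iff, ← ite_and, and_comm]
    have h2 := congrArg Complex.re φ.trace_eq_one
    rw [← Matrix.one_mul φ.mat, ← h1] at h2
    simpa only [Finset.sum_mul, Matrix.trace_sum, Complex.re_sum, Complex.one_re] using h2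
  simp only [Strategy.roundProb, ← Finset.mul_sum]
  rw [Fintype.sum_prod_type]
  simp only [Fintype.sum_prod_type, key]
  norm_num

/-- The law of one round. -/
def Strategy.roundLaw {n : ℕ} (S : Strategy n)
    (φ : DensityMatrix ((Fin n → Fin 2) × (Fin n → Fin 2))) : PMF Round :=
  PMF.ofFintype (fun r => ENNReal.ofReal (S.roundProb φ r)) (by
    rw [← ENNReal.ofReal_sum_of_nonneg fun r _ => S.roundProb_nonneg φ r, S.sum_roundProb φ,
      ENNReal.ofReal_one])

/-- The law of an infinite sequence of independent, identically distributed rounds. -/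
def Strategy.iidLaw {n : ℕ} (S : Strategy n)
    (φ : DensityMatrix ((Fin n → Fin 2) × (Fin n → Fin 2))) : Measure (ℕ → Round) :=
  Measure.infinitePi fun _ => (S.roundLaw φ).toMeasure

/-- The frequency of the answer `a` of player `D` over the first `t` rounds in which `D`
received the question `x`. (`Nat.nth q j` is the `j`-th natural number satisfying `q`,
counting from `j = 0`.) -/
def frequency (ω : ℕ → Round) (t : ℕ) (D : Player) (x : Fin 2) (a : Answer) : ℝ :=
  (((Finset.range t).filter fun j =>
    (ω (Nat.nth (fun i => (ω i).question D = x) j)).answer D = a).card : ℝ) / t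

/-- The players pass the test: the CHSH phase ends after some number `t'` of rounds, with each
player having received each question at least `t` times; and then no frequency deviates
from `1/2` by `δ` or more. -/
def passes (t : ℕ) (δ : ℝ) : Set (ℕ → Round) :=
  {ω | (∃ t' : ℕ, ∀ (D : Player) (x : Fin 2),
      t ≤ ((Finset.range t').filter fun i => (ω i).question D = x).card) ∧
    ∀ (D : Player) (x : Fin 2) (a : Answer), |frequency ω t D x a - 1 / 2| < δ}

/-- The probability that a strategy passes the test. -/
def Strategy.passProb {n : ℕ} (S : Strategy n)
    (φ : DensityMatrix ((Fin n → Fin 2) × (Fin n → Fin 2))) (t : ℕ) (δ : ℝ) : ℝ :=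
  (S.iidLaw φ).real (passes t δ)

end NoisyCHSH

end

/-! Expand the four observables in Pauli strings. Since 4Δ_ρ(Φ) = I⊗I + ρ(X⊗X − Y⊗Y + Z⊗Z), the
noisy state pairs each string only with itself, and a string with d non-identity letters is damped
by ±ρ^d. Completing squares bounds √2 times the CHSH term of a string by the total weight of the
four observables on it, and by Parseval these weights sum to at most 4. The identity string carries
weight O(δ²), by a Chernoff bound for the trace test (`pauliCoeff_obs_zero_sq_le`). Strings with d ≥
2 get at most ρ² per unit of weight, against ρ for d = 1. A value near 2√2ρ therefore forces, up to
an error η of order ε/(ρ(1−ρ)), all the weight onto degree one and makes the completed squares small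
(`degreeOne_of_violation`).

The second ingredient is of Friedgut–Kalai–Naor type: a [−1,1]-valued function on the cube with
degree-one weight close to 1 is close to a single signed coordinate (`exists_dominant_coordinate`).
Rotating every qubit so that the Bloch vector of the observable there points along Z, and taking the
diagonal, transfers this to observables (`exists_dominant_register`).

The small squares say that Alice's Bloch vectors are nearly the Hadamard image of Bob's transposed
ones. Hence all four observables live on the same register, and the two vectors of each player are
nearly orthogonal (`exists_common_register`). Gram–Schmidt gives exactly orthonormal vectors, that
is, anticommuting one-qubit observables, which one unitary conjugates to Z and X. The Frobenius
distances are read off from inner products. -/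

noncomputable section

namespace NoisyCHSH

/-! ### Rademacher sums -/

/-- The character `(-1)^b`. -/
def bitSign (b : Fin 2) : ℝ := if b = 0 then 1 else -1

theorem bitSign_sq (b : Fin 2) : bitSign b ^ 2 = 1 := by
  unfold bitSign; split_ifs <;> norm_num

theorem bitSign_add_one (b : Fin 2) : bitSign (b + 1) = -bitSign b := by
  fin_cases b <;> simp [bitSign]

section Rademacher

variable {n : ℕ}

/-- `∑ i ∈ I, l i * (-1)^(x i)`. -/
def signSum (l : Fin n → ℝ) (I : Finset (Fin n)) (x : Fin n → Fin 2) : ℝ :=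
  ∑ i ∈ I, l i * bitSign (x i)

/-- Flip the bit of `x` at `j`. -/
def flipBit (j : Fin n) (x : Fin n → Fin 2) : Fin n → Fin 2 := x + Pi.single j 1

theorem sum_flipBit (j : Fin n) (F : (Fin n → Fin 2) → ℝ) :
    ∑ x, F (flipBit j x) = ∑ x, F x :=
  Equiv.sum_comp (Equiv.addRight (Pi.single j 1 : Fin n → Fin 2)) F

theorem bitSign_flipBit_self (j : Fin n) (x : Fin n → Fin 2) :
    bitSign (flipBit j x j) = -bitSign (x j) := by
  simp [flipBit, bitSign_add_one]

theorem flipBit_of_ne {i j : Fin n} (h : i ≠ j) (x : Fin n → Fin 2) :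
    flipBit j x i = x i := by
  simp [flipBit, Pi.single_eq_of_ne h]

theorem signSum_flipBit {l : Fin n → ℝ} {I : Finset (Fin n)} {j : Fin n} (hj : j ∉ I)
    (x : Fin n → Fin 2) : signSum l I (flipBit j x) = signSum l I x :=
  Finset.sum_congr rfl fun i hi => by
    rw [flipBit_of_ne (ne_of_mem_of_not_mem hi hj)]

theorem sum_bitSign_mul {j : Fin n} {F : (Fin n → Fin 2) → ℝ}
    (hF : ∀ x, F (flipBit j x) = F x) : ∑ x, bitSign (x j) * F x = 0 := by
  have h := sum_flipBit j fun x => bitSign (x j) * F x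
  simp only [bitSign_flipBit_self, hF, neg_mul, Finset.sum_neg_distrib] at h
  linarith

theorem signSum_insert {l : Fin n → ℝ} {I : Finset (Fin n)} {j : Fin n} (hj : j ∉ I)
    (x : Fin n → Fin 2) : signSum l (insert j I) x = l j * bitSign (x j) + signSum l I x :=
  Finset.sum_insert hj

/-- Distinct signs are orthogonal, even against a weight `G` that ignores the bits in `I`. In the
application `G` is built from the sum over the complementary bits. -/
theorem sum_signSum_sq_mul (l : Fin n → ℝ) (I : Finset (Fin n)) {G : (Fin n → Fin 2) → ℝ}
    (hG : ∀ j ∈ I, ∀ x, G (flipBit j x) = G x) :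
    ∑ x, signSum l I x ^ 2 * G x = (∑ i ∈ I, l i ^ 2) * ∑ x, G x := by
  induction I using Finset.induction_on with
  | empty => simp [signSum]
  | insert j I hj ih =>
    have ih := ih fun i hi => hG i (Finset.mem_insert_of_mem hi)
    have hG' := hG j (Finset.mem_insert_self j I)
    have h0 : ∑ x, bitSign (x j) * (signSum l I x * G x) = 0 :=
      sum_bitSign_mul fun x => by rw [signSum_flipBit hj, hG']
    have hx : ∀ x, signSum l (insert j I) x ^ 2 * G x =
        l j ^ 2 * G x + 2 * l j * (bitSign (x j) * (signSum l I x * G x))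
          + signSum l I x ^ 2 * G x := fun x => by
      rw [signSum_insert hj]
      linear_combination l j ^ 2 * G x * bitSign_sq (x j)
    simp only [hx, Finset.sum_add_distrib, ← Finset.mul_sum, h0, ih, Finset.sum_insert hj]
    ring

/-- The fourth-moment Khintchine inequality, by adding one sign at a time: odd powers of the new
sign vanish, and l⁴ + 6l²v + 3v² ≤ 3(l² + v)². -/
theorem sum_signSum_pow_four_mul_le (l : Fin n → ℝ) (I : Finset (Fin n))
    {G : (Fin n → Fin 2) → ℝ} (hG : ∀ j ∈ I, ∀ x, G (flipBit j x) = G x) (h0 : ∀ x, 0 ≤ G x) :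
    ∑ x, signSum l I x ^ 4 * G x ≤ 3 * (∑ i ∈ I, l i ^ 2) ^ 2 * ∑ x, G x := by
  induction I using Finset.induction_on with
  | empty => simp [signSum]
  | insert j I hj ih =>
    have hGI : ∀ i ∈ I, ∀ x, G (flipBit i x) = G x :=
      fun i hi => hG i (Finset.mem_insert_of_mem hi)
    have ih := ih hGI
    have hG' := hG j (Finset.mem_insert_self j I)
    have h1 : ∑ x, bitSign (x j) * (signSum l I x * G x) = 0 :=
      sum_bitSign_mul fun x => by rw [signSum_flipBit hj, hG']
    have h3 : ∑ x, bitSign (x j) * (signSum l I x ^ 3 * G x) = 0 :=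
      sum_bitSign_mul fun x => by rw [signSum_flipBit hj, hG']
    have h2 := sum_signSum_sq_mul l I hGI
    have hx : ∀ x, signSum l (insert j I) x ^ 4 * G x =
        l j ^ 4 * G x + 4 * l j ^ 3 * (bitSign (x j) * (signSum l I x * G x))
          + 6 * l j ^ 2 * (signSum l I x ^ 2 * G x)
          + 4 * l j * (bitSign (x j) * (signSum l I x ^ 3 * G x))
          + signSum l I x ^ 4 * G x := fun x => by
      rw [signSum_insert hj]
      linear_combination (l j ^ 4 * G x * (bitSign (x j) ^ 2 + 1)
        + 4 * l j ^ 3 * signSum l I x * G x * bitSign (x j)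
        + 6 * l j ^ 2 * signSum l I x ^ 2 * G x) * bitSign_sq (x j)
    simp only [hx, Finset.sum_add_distrib, ← Finset.mul_sum, h1, h2, h3, Finset.sum_insert hj]
    have hs : 0 ≤ ∑ x, G x := Finset.sum_nonneg fun x _ => h0 x
    nlinarith [mul_nonneg (sq_nonneg (l j ^ 2)) hs]

theorem sum_signSum_sq (l : Fin n → ℝ) (I : Finset (Fin n)) :
    ∑ x, signSum l I x ^ 2 = (∑ i ∈ I, l i ^ 2) * 2 ^ n := by
  have h := sum_signSum_sq_mul l I (G := fun _ => 1) fun _ _ _ => rfl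
  simpa using h

/-- The bits in `I` are flipped by adding the indicator of `I`. -/
theorem signSum_add_indicator (l : Fin n → ℝ) (I : Finset (Fin n)) (x : Fin n → Fin 2) :
    signSum l Finset.univ (x + fun i => if i ∈ I then 1 else 0)
      = signSum l Iᶜ x - signSum l I x := by
  unfold signSum
  rw [← Finset.sum_compl_add_sum I, sub_eq_add_neg, ← Finset.sum_neg_distrib]
  congr 1
  · refine Finset.sum_congr rfl fun i hi => ?_
    simp [Finset.mem_compl.mp hi]
  · refine Finset.sum_congr rfl fun i hi => ?_
    simp [hi, bitSign_add_one]

/-- The numbers |a + b| and |b − a| are, in some order, the sum and the difference of |a| and |b|,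
so they differ by twice the smaller one. -/
theorem abs_add_sub_abs_sub_sq (a b : ℝ) :
    (|a + b| - |b - a|) ^ 2 = 4 * min (a ^ 2) (b ^ 2) := by
  have h1 := sq_abs (a + b)
  have h2 := sq_abs (b - a)
  have h3 : |a + b| * |b - a| = |b ^ 2 - a ^ 2| := by rw [← abs_mul]; ring_nf
  rcases le_total (a ^ 2) (b ^ 2) with h | h
  · rw [min_eq_left h]
    rw [abs_of_nonneg (sub_nonneg.2 h)] at h3
    nlinarith
  · rw [min_eq_right h]
    rw [abs_of_nonpos (sub_nonpos.2 h)] at h3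
    nlinarith

/-- A polynomial minorant of the minimum, whose mean needs only second and fourth moments. The
parabola y(2/3 − y/9) has maximum 1, at y = 3. -/
theorem mul_mul_le_min {a b : ℝ} (ha : 0 ≤ a) (hb : 0 ≤ b) :
    a * b * (2 / 3 - (a + b) / 9) ≤ min a b := by
  refine le_min ?_ ?_
  · have : b * (2 / 3 - (a + b) / 9) ≤ 1 := by nlinarith [sq_nonneg (b - 3), mul_nonneg ha hb]
    nlinarith
  · have : a * (2 / 3 - (a + b) / 9) ≤ 1 := by nlinarith [sq_nonneg (a - 3), mul_nonneg ha hb]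
    nlinarith

variable {f : (Fin n → Fin 2) → ℝ} {l : Fin n → ℝ}

/-- Let L be the linear part of f and s its weight. Then E|L| ≥ E(fL) = s and E L² = s, so E(|L| −
1)² ≤ s − 2s + 1. -/
theorem sum_abs_signSum_sub_one_sq_le (hf : ∀ x, |f x| ≤ 1)
    (hl : ∀ k, ∑ x, f x * bitSign (x k) = l k * 2 ^ n) :
    ∑ x, (|signSum l Finset.univ x| - 1) ^ 2 ≤ (1 - ∑ k, l k ^ 2) * 2 ^ n := by
  have h1 : ∑ x, f x * signSum l Finset.univ x = (∑ k, l k ^ 2) * 2 ^ n := by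
    simp only [signSum, Finset.mul_sum]
    rw [Finset.sum_comm, Finset.sum_mul]
    refine Finset.sum_congr rfl fun k _ => ?_
    rw [sq, mul_assoc, ← hl k, Finset.mul_sum]
    exact Finset.sum_congr rfl fun x _ => by ring
  have h2 : ∑ x, f x * signSum l Finset.univ x ≤ ∑ x, |signSum l Finset.univ x| :=
    Finset.sum_le_sum fun x _ => by
      refine (le_abs_self _).trans ?_
      rw [abs_mul]
      exact mul_le_of_le_one_left (abs_nonneg _) (hf x)
  have h3 : ∀ x, (|signSum l Finset.univ x| - 1) ^ 2
      = signSum l Finset.univ x ^ 2 - 2 * |signSum l Finset.univ x| + 1 := fun x => by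
    rw [sub_sq, sq_abs]; ring
  simp only [h3, Finset.sum_add_distrib, Finset.sum_sub_distrib, ← Finset.mul_sum,
    sum_signSum_sq]
  simp only [Finset.sum_const, Finset.card_univ, Fintype.card_pi, Fintype.card_fin,
    Finset.prod_const, nsmul_eq_mul, Nat.cast_pow, Nat.cast_ofNat, mul_one]
  linarith

/-- Splitting the coordinates in two, one of the two parts carries almost no weight. -/
theorem weight_mul_weight_compl_le (hf : ∀ x, |f x| ≤ 1)
    (hl : ∀ k, ∑ x, f x * bitSign (x k) = l k * 2 ^ n) (hs : ∑ k, l k ^ 2 ≤ 1)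
    (I : Finset (Fin n)) :
    (∑ k ∈ I, l k ^ 2) * (∑ k ∈ Iᶜ, l k ^ 2) ≤ 3 * (1 - ∑ k, l k ^ 2) := by
  set α := ∑ k ∈ I, l k ^ 2 with hα
  set β := ∑ k ∈ Iᶜ, l k ^ 2 with hβ
  have hα0 : 0 ≤ α := Finset.sum_nonneg fun _ _ => sq_nonneg _
  have hβ0 : 0 ≤ β := Finset.sum_nonneg fun _ _ => sq_nonneg _
  have hαβ : α + β = ∑ k, l k ^ 2 := Finset.sum_add_sum_compl I _
  have hE := sum_abs_signSum_sub_one_sq_le hf hl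
  set A := signSum l I
  set B := signSum l Iᶜ
  have hAB : ∀ x, signSum l Finset.univ x = A x + B x := fun x =>
    (Finset.sum_add_sum_compl I _).symm
  -- Flipping the bits in `I` permutes the cube and turns A + B into B − A, so both absolute values
  -- are close to 1 on average, hence close to each other.
  have hE' : ∑ x, (|B x - A x| - 1) ^ 2 ≤ (1 - ∑ k, l k ^ 2) * 2 ^ n := by
    rw [← Equiv.sum_comp (Equiv.addRight fun i => if i ∈ I then (1 : Fin 2) else 0)] at hE
    simpa only [Equiv.coe_addRight, signSum_add_indicator] using hE
  simp only [hAB] at hE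
  have hI : ∀ j ∈ I, ∀ x, B (flipBit j x) = B x := fun j hj x =>
    signSum_flipBit (by simpa using hj) x
  have hIc : ∀ j ∈ Iᶜ, ∀ x, A (flipBit j x) = A x := fun j hj x =>
    signSum_flipBit (by simpa using hj) x
  have m22 : ∑ x, A x ^ 2 * B x ^ 2 = α * (β * 2 ^ n) := by
    rw [sum_signSum_sq_mul l I (G := fun x => B x ^ 2) fun j hj x => by simp only [hI j hj],
      sum_signSum_sq]
  have m42 : ∑ x, A x ^ 4 * B x ^ 2 ≤ 3 * α ^ 2 * (β * 2 ^ n) := by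
    refine (sum_signSum_pow_four_mul_le l I (G := fun x => B x ^ 2)
      (fun j hj x => by simp only [hI j hj]) fun x => sq_nonneg _).trans_eq ?_
    rw [sum_signSum_sq]
  have m24 : ∑ x, B x ^ 4 * A x ^ 2 ≤ 3 * β ^ 2 * (α * 2 ^ n) := by
    refine (sum_signSum_pow_four_mul_le l Iᶜ (G := fun x => A x ^ 2)
      (fun j hj x => by simp only [hIc j hj]) fun x => sq_nonneg _).trans_eq ?_
    rw [sum_signSum_sq]
  -- Both sides enclose min(A², B²). On averaging, the left side is at least αβ(2/3 − (α + β)/3) ≥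
  -- αβ/3.
  have key : ∀ x, 2 / 3 * (A x ^ 2 * B x ^ 2) - 1 / 9 * (A x ^ 4 * B x ^ 2)
      - 1 / 9 * (B x ^ 4 * A x ^ 2)
      ≤ 1 / 2 * (|A x + B x| - 1) ^ 2 + 1 / 2 * (|B x - A x| - 1) ^ 2 := fun x => by
    have h1 := mul_mul_le_min (sq_nonneg (A x)) (sq_nonneg (B x))
    have h2 := abs_add_sub_abs_sub_sq (A x) (B x)
    nlinarith [sq_nonneg ((|A x + B x| - 1) + (|B x - A x| - 1))]
  have hsum := Finset.sum_le_sum fun x (_ : x ∈ Finset.univ) => key x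
  simp only [Finset.sum_add_distrib, Finset.sum_sub_distrib, ← Finset.mul_sum] at hsum
  have hN : (0 : ℝ) < 2 ^ n := by positivity
  rw [← hαβ] at hE hE' hs ⊢
  have : α * β * 2 ^ n ≤ 3 * (1 - (α + β)) * 2 ^ n := by
    have h3 : α * β * 2 ^ n * (1 - (α + β)) ≥ 0 :=
      mul_nonneg (by positivity) (by linarith)
    nlinarith
  exact le_of_mul_le_mul_right this hN

/-- A bounded function on the cube whose degree-one weight is close to `1` has a single
coordinate that carries almost all of this weight. -/
theorem exists_dominant_coordinate (hn : 1 ≤ n) (hf : ∀ x, |f x| ≤ 1)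
    (hl : ∀ k, ∑ x, f x * bitSign (x k) = l k * 2 ^ n) (hs : ∑ k, l k ^ 2 ≤ 1) :
    ∃ k, 1 - 14 * (1 - ∑ k, l k ^ 2) ≤ l k ^ 2 := by
  set s := ∑ k, l k ^ 2 with hsdef
  have hN : (0 : ℝ) < 2 ^ n := by positivity
  -- The point `y` encodes a subset, and αβ = ((α + β)² − (α − β)²)/4. Averaging over all subsets
  -- replaces (α − β)² by ∑ l⁴.
  have hsplit : ∀ y : Fin n → Fin 2,
      1 / 4 * (s ^ 2 - signSum (fun k => l k ^ 2) Finset.univ y ^ 2) ≤ 3 * (1 - s) := fun y => by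
    refine le_trans (le_of_eq ?_)
      (weight_mul_weight_compl_le hf hl hs (Finset.univ.filter fun k => y k = 0))
    have h1 := Finset.sum_add_sum_compl (Finset.univ.filter fun k => y k = 0) fun k => l k ^ 2
    have h2 : signSum (fun k => l k ^ 2) Finset.univ y
        = (∑ k ∈ Finset.univ.filter fun k => y k = 0, l k ^ 2)
          - ∑ k ∈ (Finset.univ.filter fun k => y k = 0)ᶜ, l k ^ 2 := by
      unfold signSum
      rw [← Finset.sum_add_sum_compl (Finset.univ.filter fun k => y k = 0), sub_eq_add_neg,
        ← Finset.sum_neg_distrib]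
      congr 1 <;> refine Finset.sum_congr rfl fun k hk => ?_
      · simp [bitSign, (Finset.mem_filter.mp hk).2]
      · have : y k ≠ 0 := by simpa using hk
        simp [bitSign, this]
    rw [h2, hsdef, ← h1]
    ring
  have hsum := Finset.sum_le_sum fun y (_ : y ∈ Finset.univ) => hsplit y
  rw [← Finset.mul_sum, Finset.sum_sub_distrib, sum_signSum_sq] at hsum
  simp only [Finset.sum_const, Finset.card_univ, Fintype.card_pi, Fintype.card_fin,
    Finset.prod_const, nsmul_eq_mul, Nat.cast_pow, Nat.cast_ofNat] at hsum
  have h4 : s ^ 2 - ∑ k, (l k ^ 2) ^ 2 ≤ 12 * (1 - s) :=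
    le_of_mul_le_mul_right (by linarith) hN
  have : Nonempty (Fin n) := ⟨⟨0, hn⟩⟩
  obtain ⟨k, -, hk⟩ := Finset.exists_max_image Finset.univ (fun k => l k ^ 2)
    Finset.univ_nonempty
  refine ⟨k, ?_⟩
  have h5 : ∑ i, (l i ^ 2) ^ 2 ≤ l k ^ 2 * s := by
    rw [hsdef, Finset.mul_sum]
    exact Finset.sum_le_sum fun i hi => by
      rw [sq (l i ^ 2)]
      exact mul_le_mul_of_nonneg_right (hk i hi) (sq_nonneg _)
  -- Here l_k² ≥ l_k² s ≥ s² − 12(1 − s), and s² ≥ 1 − 2(1 − s); this makes 14.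
  nlinarith [sq_nonneg (l k), sq_nonneg (1 - s)]

end Rademacher

/-! ### A concentration inequality for selected rounds -/

section Selection

open ENNReal

variable {α : Type} [Fintype α] [MeasurableSpace α] [MeasurableSingletonClass α] [Nonempty α]

theorem measurable_of_dependsOn_prefix {β : Type} [MeasurableSpace β] {N : ℕ}
    {F : (ℕ → α) → β} (hF : ∀ ω ω', (∀ i < N, ω i = ω' i) → F ω = F ω') :
    ∃ G : (Finset.range N → α) → β, Measurable G ∧ ∀ ω, F ω = G fun i => ω i := by
  refine ⟨fun r => F fun i => if h : i ∈ Finset.range N then r ⟨i, h⟩ else Classical.arbitrary α,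
    measurable_of_finite _, fun ω => hF _ _ fun i hi => ?_⟩
  simp [hi]

/-- Round `N` is independent of the earlier rounds; this is the one-step conditioning behind the
supermartingale property below. -/
theorem lintegral_prefix_mul_eval (ν : Measure α) [IsProbabilityMeasure ν] {N : ℕ}
    {F : (ℕ → α) → ℝ≥0∞} (hF : ∀ ω ω', (∀ i < N, ω i = ω' i) → F ω = F ω') (h : α → ℝ≥0∞) :
    ∫⁻ ω, F ω * h (ω N) ∂Measure.infinitePi (fun _ : ℕ => ν)
      = (∫⁻ ω, F ω ∂Measure.infinitePi fun _ : ℕ => ν) * ∫⁻ r, h r ∂ν := by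
  obtain ⟨G, hG, hFG⟩ := measurable_of_dependsOn_prefix hF
  have hh : Measurable h := measurable_of_finite h
  have hind := (ProbabilityTheory.iIndepFun_infinitePi (P := fun _ : ℕ => ν)
    (X := fun _ r => r) fun _ => measurable_id).indepFun_finset (Finset.range N) {N}
    (by simp) fun i => measurable_pi_apply i
  have hmeas : Measurable fun ω : ℕ → α => fun i : Finset.range N => ω i :=
    measurable_pi_lambda _ fun i => measurable_pi_apply _
  have hind' := hind.comp (φ := G)
    (ψ := fun r : (({N} : Finset ℕ) → α) => h (r ⟨N, by simp⟩)) hG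
    (hh.comp (measurable_pi_apply _))
  have key := ProbabilityTheory.lintegral_mul_eq_lintegral_mul_lintegral_of_indepFun
    (hG.comp hmeas) (hh.comp (measurable_pi_apply N)) hind'
  have hlast : ∫⁻ ω, h (ω N) ∂Measure.infinitePi (fun _ : ℕ => ν) = ∫⁻ r, h r ∂ν := by
    conv_rhs => rw [← Measure.infinitePi_map_eval (fun _ : ℕ => ν) N]
    rw [lintegral_map hh (measurable_pi_apply N)]
  simp only [hFG]
  rw [← hlast]
  exact key

variable (Q : α → Prop) [DecidablePred Q] (h : α → ℝ≥0∞) (t : ℕ)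

/-- The product of the values `h` over the first `t` among the first `N` rounds which satisfy
`Q`. -/
def stoppedProd (N : ℕ) (ω : ℕ → α) : ℝ≥0∞ :=
  ∏ i ∈ Finset.range N, if Q (ω i) ∧ Nat.count (fun j => Q (ω j)) i < t then h (ω i) else 1

omit [Fintype α] [MeasurableSpace α] [MeasurableSingletonClass α] [Nonempty α] in
theorem count_congr_prefix {N : ℕ} {ω ω' : ℕ → α} (hω : ∀ i < N, ω i = ω' i) :
    Nat.count (fun j => Q (ω j)) N = Nat.count (fun j => Q (ω' j)) N := by
  simp only [Nat.count_eq_card_filter_range]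
  congr 1
  exact Finset.filter_congr fun i hi => by rw [hω i (Finset.mem_range.mp hi)]

omit [Fintype α] [MeasurableSpace α] [MeasurableSingletonClass α] [Nonempty α] in
theorem stoppedProd_congr {N : ℕ} {ω ω' : ℕ → α} (hω : ∀ i < N, ω i = ω' i) :
    stoppedProd Q h t N ω = stoppedProd Q h t N ω' :=
  Finset.prod_congr rfl fun i hi => by
    have hi := Finset.mem_range.mp hi
    rw [hω i hi, count_congr_prefix Q fun j hj => hω j (hj.trans hi)]

/-- The stopped product is a nonnegative supermartingale started at 1. -/
theorem lintegral_stoppedProd_le_one (ν : Measure α) [IsProbabilityMeasure ν]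
    (hν : ∫⁻ r, (if Q r then h r else 1) ∂ν ≤ 1) (N : ℕ) :
    ∫⁻ ω, stoppedProd Q h t N ω ∂Measure.infinitePi (fun _ : ℕ => ν) ≤ 1 := by
  induction N with
  | zero => simp [stoppedProd]
  | succ N ih =>
    -- Whether the product is already frozen (`F'`) or may gain a factor in round `N` (`F`) depends
    -- on the earlier rounds only.
    let c : (ℕ → α) → ℕ := fun ω => Nat.count (fun j => Q (ω j)) N
    let F : (ℕ → α) → ℝ≥0∞ := fun ω => if c ω < t then stoppedProd Q h t N ω else 0
    let F' : (ℕ → α) → ℝ≥0∞ := fun ω => if c ω < t then 0 else stoppedProd Q h t N ω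
    have hF : ∀ ω ω', (∀ i < N, ω i = ω' i) → F ω = F ω' := fun ω ω' hω => by
      simp only [F, c, stoppedProd_congr Q h t hω, count_congr_prefix Q hω]
    have hFm : Measurable F := by
      obtain ⟨G, hG, hFG⟩ := measurable_of_dependsOn_prefix hF
      rw [funext hFG]
      exact hG.comp (measurable_pi_lambda _ fun i => measurable_pi_apply _)
    have hstep : ∀ ω, stoppedProd Q h t (N + 1) ω
        = F ω * (if Q (ω N) then h (ω N) else 1) + F' ω := fun ω => by
      by_cases hc : c ω < t
      · simp only [stoppedProd, Finset.prod_range_succ, F, F', hc, if_true, add_zero]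
        congr 1
        exact if_congr (and_iff_left hc) rfl rfl
      · simp only [stoppedProd, Finset.prod_range_succ, F, F', hc, if_false, zero_mul, zero_add]
        rw [if_neg fun hQ => hc hQ.2, mul_one]
    have hsum : ∀ ω, stoppedProd Q h t N ω = F ω + F' ω := fun ω => by
      by_cases hc : c ω < t <;> simp [F, F', hc]
    simp only [hstep]
    have hm : Measurable fun ω : ℕ → α => F ω * (if Q (ω N) then h (ω N) else 1) :=
      hFm.mul ((measurable_of_finite fun r => if Q r then h r else 1).comp (measurable_pi_apply N))
    rw [lintegral_add_left hm, lintegral_prefix_mul_eval ν hF fun r => if Q r then h r else 1]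
    simp only [hsum] at ih
    rw [lintegral_add_left hFm] at ih
    exact (add_le_add_left (mul_le_of_le_one_right' hν) _).trans ih

omit [Fintype α] [MeasurableSpace α] [MeasurableSingletonClass α] [Nonempty α] in
theorem stoppedProd_eq_prod_nth {N : ℕ} {ω : ℕ → α}
    (hN : t ≤ Nat.count (fun j => Q (ω j)) N) :
    stoppedProd Q h t N ω = ∏ j ∈ Finset.range t, h (ω (Nat.nth (fun i => Q (ω i)) j)) := by
  unfold stoppedProd
  rw [← Finset.prod_filter]
  -- If only finitely many rounds are selected, `Nat.nth` takes the default value 0 beyond the last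
  -- one; the indices below `t` avoid this.
  have hcard : ∀ j < t, ∀ hf : (Set.ofPred fun i => Q (ω i)).Finite, j < hf.toFinset.card :=
    fun j hj hf => by
      refine (hj.trans_le hN).trans_le ?_
      rw [Nat.count_eq_card_filter_range]
      exact Finset.card_le_card fun i hi => by simpa using (Finset.mem_filter.mp hi).2
  refine Finset.prod_bij' (fun i _ => Nat.count (fun j => Q (ω j)) i)
    (fun j _ => Nat.nth (fun i => Q (ω i)) j) ?_ ?_ ?_ ?_ ?_
  · intro i hi
    exact Finset.mem_range.mpr (Finset.mem_filter.mp hi).2.2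
  · intro j hj
    have hj := Finset.mem_range.mp hj
    refine Finset.mem_filter.mpr ⟨Finset.mem_range.mpr
      (Nat.nth_lt_of_lt_count (hj.trans_le hN)), Nat.nth_mem j (hcard j hj), ?_⟩
    rw [Nat.count_nth (hcard j hj)]
    exact hj
  · intro i hi
    exact Nat.nth_count (p := fun i => Q (ω i)) (Finset.mem_filter.mp hi).2.1
  · intro j hj
    exact Nat.count_nth (hcard j (Finset.mem_range.mp hj))
  · intro i hi
    rw [Nat.nth_count (p := fun i => Q (ω i)) (Finset.mem_filter.mp hi).2.1]

/-- Markov's inequality for the product of `h` over the first `t` rounds which satisfy `Q`. -/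
theorem mul_measure_prod_nth_le_one (ν : Measure α) [IsProbabilityMeasure ν]
    (hν : ∫⁻ r, (if Q r then h r else 1) ∂ν ≤ 1) (c : ℝ≥0∞) :
    c * Measure.infinitePi (fun _ : ℕ => ν)
      {ω | (∃ N, t ≤ Nat.count (fun j => Q (ω j)) N) ∧
        c ≤ ∏ j ∈ Finset.range t, h (ω (Nat.nth (fun i => Q (ω i)) j))} ≤ 1 := by
  set A : ℕ → Set (ℕ → α) := fun N => {ω | t ≤ Nat.count (fun j => Q (ω j)) N ∧
        c ≤ ∏ j ∈ Finset.range t, h (ω (Nat.nth (fun i => Q (ω i)) j))}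
  have hA : {ω | (∃ N, t ≤ Nat.count (fun j => Q (ω j)) N) ∧
        c ≤ ∏ j ∈ Finset.range t, h (ω (Nat.nth (fun i => Q (ω i)) j))} = ⋃ N, A N := by
    ext ω
    simp [A]
  -- The events increase with the horizon, so continuity from below reduces the claim to Markov's
  -- inequality at a fixed `N`.
  have hmono : Monotone A := fun M N hMN ω hω =>
    ⟨hω.1.trans (Nat.count_monotone _ hMN), hω.2⟩
  rw [hA, hmono.directed_le.measure_iUnion, ENNReal.mul_iSup]
  refine iSup_le fun N => ?_
  have hm : Measurable (stoppedProd Q h t N) := by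
    obtain ⟨G, hG, hFG⟩ := measurable_of_dependsOn_prefix
      (F := stoppedProd Q h t N) fun _ _ => stoppedProd_congr Q h t
    rw [funext hFG]
    exact hG.comp (measurable_pi_lambda _ fun i => measurable_pi_apply _)
  refine le_trans ?_ ((mul_meas_ge_le_lintegral hm c).trans
    (lintegral_stoppedProd_le_one Q h t ν hν N))
  gcongr
  intro ω hω
  exact hω.2.trans_eq (stoppedProd_eq_prod_nth Q h t hω.1).symm

end Selection

/-! ### The Chernoff bound for the trace test -/

theorem exp_mul_le_cosh_add {s z : ℝ} (h1 : -1 ≤ z) (h2 : z ≤ 1) :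
    Real.exp (s * z) ≤ Real.cosh s + z * Real.sinh s := by
  have h := convexOn_exp.2 (Set.mem_univ s) (Set.mem_univ (-s))
    (show (0 : ℝ) ≤ (1 + z) / 2 by linarith) (show (0 : ℝ) ≤ (1 - z) / 2 by linarith) (by ring)
  simp only [smul_eq_mul] at h
  rw [Real.cosh_eq, Real.sinh_eq]
  calc Real.exp (s * z) = Real.exp ((1 + z) / 2 * s + (1 - z) / 2 * -s) := by ring_nf
    _ ≤ _ := h
    _ = _ := by ring

section Test

variable {n : ℕ} (S : Strategy n) (φ : DensityMatrix ((Fin n → Fin 2) × (Fin n → Fin 2)))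

theorem lintegral_roundLaw {g : Round → ℝ} (hg : ∀ r, 0 ≤ g r) :
    ∫⁻ r, ENNReal.ofReal (g r) ∂(S.roundLaw φ).toMeasure
      = ENNReal.ofReal (∑ r, g r * S.roundProb φ r) := by
  rw [lintegral_fintype, ENNReal.ofReal_sum_of_nonneg
    fun r _ => mul_nonneg (hg r) (S.roundProb_nonneg φ r)]
  refine Finset.sum_congr rfl fun r _ => ?_
  rw [PMF.toMeasure_apply_singleton _ _ (measurableSet_singleton r), ENNReal.ofReal_mul (hg r)]
  rfl

/-- The probability that the frequency of an answer exceeds its expectation `q` by `s`. -/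
theorem measure_frequency_ge (D : Player) (x : Fin 2) (a : Answer) {q : ℝ}
    (hq0 : 0 ≤ q) (hq1 : q ≤ 1)
    (hq : ∑ r : Round, (if r.question D = x then (if r.answer D = a then 1 else 0) - q else 0)
      * S.roundProb φ r = 0)
    {t : ℕ} (ht : 1 ≤ t) {s : ℝ} (hs : 0 ≤ s) :
    (S.iidLaw φ).real {ω | (∃ N, t ≤ Nat.count (fun j => (ω j).question D = x) N) ∧
      q + s ≤ frequency ω t D x a} ≤ Real.exp (-(t * s ^ 2 / 2)) := by
  set z : Round → ℝ := fun r => (if r.answer D = a then 1 else 0) - q with hz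
  have hz1 : ∀ r, -1 ≤ z r ∧ z r ≤ 1 := fun r => by
    simp only [hz]; split_ifs <;> constructor <;> linarith
  -- The exponential tilt equals the deviation `s` itself, which optimizes the exponent −λs + λ²/2
  -- over λ.
  set g : Round → ℝ := fun r => Real.exp (s * z r - s ^ 2 / 2) with hg
  set Q : Round → Prop := fun r => r.question D = x
  have hsum : ∑ r, (if Q r then g r else 1) * S.roundProb φ r ≤ 1 := by
    have hexp : Real.exp (-(s ^ 2 / 2)) * Real.cosh s ≤ 1 := by
      calc _ ≤ Real.exp (-(s ^ 2 / 2)) * Real.exp (s ^ 2 / 2) := by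
            gcongr; exact Real.cosh_le_exp_half_sq s
        _ = 1 := by rw [← Real.exp_add]; simp
    -- The exponential is majorized by an affine function of `z`, so the centering `hq` alone bounds
    -- the mean by 1.
    have hpt : ∀ r, (if Q r then g r else 1) ≤
        1 + Real.exp (-(s ^ 2 / 2)) * Real.sinh s * (if Q r then z r else 0) := fun r => by
      split_ifs with hr
      · calc g r = Real.exp (-(s ^ 2 / 2)) * Real.exp (s * z r) := by
              rw [hg, ← Real.exp_add]; ring_nf
          _ ≤ Real.exp (-(s ^ 2 / 2)) * (Real.cosh s + z r * Real.sinh s) := by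
              gcongr; exact exp_mul_le_cosh_add (hz1 r).1 (hz1 r).2
          _ ≤ _ := by linarith
      · simp
    calc _ ≤ ∑ r, (1 + Real.exp (-(s ^ 2 / 2)) * Real.sinh s * (if Q r then z r else 0))
          * S.roundProb φ r := Finset.sum_le_sum fun r _ =>
            mul_le_mul_of_nonneg_right (hpt r) (S.roundProb_nonneg φ r)
      _ = 1 := by
        simp only [add_mul, Finset.sum_add_distrib, one_mul, S.sum_roundProb φ, mul_assoc,
          ← Finset.mul_sum]
        rw [hq]; simp
  have hν : ∫⁻ r, (if Q r then ENNReal.ofReal (g r) else 1) ∂(S.roundLaw φ).toMeasure ≤ 1 := by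
    have : ∀ r, (if Q r then ENNReal.ofReal (g r) else 1)
        = ENNReal.ofReal (if Q r then g r else 1) := fun r => by split_ifs <;> simp
    simp only [this]
    rw [lintegral_roundLaw S φ fun r => by split_ifs <;> positivity]
    exact ENNReal.ofReal_le_one.mpr hsum
  have key := mul_measure_prod_nth_le_one Q (fun r => ENNReal.ofReal (g r)) t
    (S.roundLaw φ).toMeasure hν (ENNReal.ofReal (Real.exp (t * s ^ 2 / 2)))
  have hsub : {ω : ℕ → Round | (∃ N, t ≤ Nat.count (fun j => (ω j).question D = x) N) ∧
      q + s ≤ frequency ω t D x a} ⊆ {ω | (∃ N, t ≤ Nat.count (fun j => Q (ω j)) N) ∧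
        ENNReal.ofReal (Real.exp (t * s ^ 2 / 2)) ≤
          ∏ j ∈ Finset.range t, ENNReal.ofReal (g (ω (Nat.nth (fun i => Q (ω i)) j)))} := by
    rintro ω ⟨h1, h2⟩
    refine ⟨h1, ?_⟩
    rw [← ENNReal.ofReal_prod_of_nonneg fun _ _ => (Real.exp_pos _).le, ← Real.exp_sum]
    refine ENNReal.ofReal_le_ofReal (Real.exp_le_exp.mpr ?_)
    have ht0 : (0 : ℝ) < t := by exact_mod_cast ht
    have h3 : ∑ j ∈ Finset.range t, z (ω (Nat.nth (fun i => Q (ω i)) j))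
        = t * (frequency ω t D x a - q) := by
      simp only [hz, Finset.sum_sub_distrib, Finset.sum_const, Finset.card_range, nsmul_eq_mul,
        Finset.sum_boole, frequency, mul_sub]
      rw [mul_div_cancel₀ _ ht0.ne']
    rw [Finset.sum_sub_distrib, ← Finset.mul_sum, h3, Finset.sum_const, Finset.card_range,
      nsmul_eq_mul]
    have h4 : s ≤ frequency ω t D x a - q := by linarith
    have h5 := mul_le_mul_of_nonneg_left h4 (mul_nonneg ht0.le hs)
    nlinarith
  have hle : ENNReal.ofReal (Real.exp (t * s ^ 2 / 2)) * S.iidLaw φ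
      {ω : ℕ → Round | (∃ N, t ≤ Nat.count (fun j => (ω j).question D = x) N) ∧
      q + s ≤ frequency ω t D x a} ≤ 1 :=
    (mul_le_mul_right (measure_mono hsub) _).trans key
  have hreal := ENNReal.toReal_mono ENNReal.one_ne_top hle
  rw [ENNReal.toReal_mul, ENNReal.toReal_ofReal (Real.exp_pos _).le, ENNReal.toReal_one] at hreal
  rw [Real.exp_neg]
  exact (le_inv_mul_iff₀ (Real.exp_pos _)).mpr hreal |>.trans_eq (mul_one _)

/-- If the test is passed with probability `p`, no answer can be rare. -/
theorem half_sub_lt_of_le_passProb (D : Player) (x : Fin 2) (a : Answer) {q : ℝ}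
    (hq0 : 0 ≤ q) (hq1 : q ≤ 1)
    (hq : ∑ r : Round, (if r.question D = x then (if r.answer D = a then 1 else 0) - q else 0)
      * S.roundProb φ r = 0)
    {t : ℕ} (ht : 1 ≤ t) {p δ : ℝ} (hp : 0 < p) (hδ : δ = Real.sqrt (2 * Real.log (2 / p) / t))
    (hpass : p ≤ S.passProb φ t δ) : 1 / 2 - 2 * δ < q := by
  by_contra! hcon
  have ht0 : (0 : ℝ) < t := by exact_mod_cast ht
  have hprob : IsProbabilityMeasure (S.iidLaw φ) := by
    unfold Strategy.iidLaw; infer_instance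
  have hp1 : p ≤ 1 := hpass.trans measureReal_le_one
  -- Needed since `Real.sqrt` is 0 on negative numbers: only now does δ² recover the logarithm.
  have hlog : 0 ≤ Real.log (2 / p) := Real.log_nonneg (by rw [le_div_iff₀ hp]; linarith)
  have hδ0 : 0 ≤ δ := hδ ▸ Real.sqrt_nonneg _
  have hδ2 : t * δ ^ 2 / 2 = Real.log (2 / p) := by
    rw [hδ, Real.sq_sqrt (by positivity)]
    field_simp
  have h1 := measure_frequency_ge S φ D x a hq0 hq1 hq ht hδ0
  -- If q ≤ 1/2 − 2δ, passing requires a frequency above 1/2 − δ ≥ q + δ. The bound equals p/2,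
  -- which contradicts a pass probability of at least p.
  have h2 : S.passProb φ t δ ≤ Real.exp (-(t * δ ^ 2 / 2)) := by
    refine le_trans (measureReal_mono ?_) h1
    rintro ω ⟨⟨t', ht'⟩, hfreq⟩
    refine ⟨⟨t', ?_⟩, ?_⟩
    · rw [Nat.count_eq_card_filter_range]
      exact ht' D x
    · have := (abs_lt.mp (hfreq D x a)).1
      linarith
  rw [hδ2, Real.exp_neg, Real.exp_log (by positivity), inv_div] at h2
  linarith

end Test

/-! ### Pauli strings -/

/-- The Pauli matrices `I, X, Y, Z`. -/
def pauli : Fin 4 → Matrix (Fin 2) (Fin 2) ℂ :=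
  ![1, pauliX, !![0, -Complex.I; Complex.I, 0], pauliZ]

theorem pauli_conjTranspose (a : Fin 4) : (pauli a).conjTranspose = pauli a := by
  ext i j
  fin_cases a <;> fin_cases i <;> fin_cases j <;> simp [pauli, pauliX, pauliZ]

theorem trace_pauli (a : Fin 4) : (pauli a).trace = if a = 0 then 2 else 0 := by
  fin_cases a <;> simp [pauli, pauliX, pauliZ, Matrix.trace_fin_two]

/-- Completeness of the Pauli basis: ∑ σ⊗σ is twice the swap operator. -/
theorem sum_pauli_mul_pauli (y x w z : Fin 2) :
    ∑ a, pauli a y x * pauli a w z = if y = z ∧ x = w then 2 else 0 := by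
  rw [Fin.sum_univ_four]
  fin_cases y <;> fin_cases x <;> fin_cases w <;> fin_cases z <;>
    simp [pauli, pauliX, pauliZ] <;> norm_num

/-- The coefficients of `4 Δ_ρ(Φ)` along `σ ⊗ σ`, for the four Pauli matrices `σ`. -/
def noiseCoeff (ρ : ℝ) : Fin 4 → ℝ := ![1, ρ, -ρ, ρ]

theorem depolarize_epr_apply (ρ : ℝ) (y x w z : Fin 2) :
    depolarize ρ epr (y, w) (x, z)
      = 1 / 4 * ∑ a, (noiseCoeff ρ a : ℂ) * (pauli a y x * pauli a w z) := by
  have h : (((Real.sqrt 2 : ℝ) : ℂ))⁻¹ * ((Real.sqrt 2 : ℝ) : ℂ)⁻¹ = 1 / 2 := by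
    rw [← mul_inv, ← Complex.ofReal_mul, Real.mul_self_sqrt (by norm_num)]
    norm_num
  unfold depolarize
  rw [trace_epr, Fin.sum_univ_four]
  fin_cases y <;> fin_cases x <;> fin_cases w <;> fin_cases z <;>
    simp [pauli, pauliX, pauliZ, noiseCoeff, epr, eprVec, Matrix.vecMulVec_apply, h] <;>
    ring

section Strings

variable {n : ℕ}

def pauliString (σ : Fin n → Fin 4) : Matrix (Fin n → Fin 2) (Fin n → Fin 2) ℂ :=
  tensor fun i => pauli (σ i)

theorem pauliString_conjTranspose (σ : Fin n → Fin 4) :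
    (pauliString σ).conjTranspose = pauliString σ := by
  simp [pauliString, conjTranspose_tensor, pauli_conjTranspose]

theorem trace_mul_pauliString (A : Matrix (Fin n → Fin 2) (Fin n → Fin 2) ℂ)
    (σ : Fin n → Fin 4) :
    (A * pauliString σ).trace = ∑ x, ∑ y, A x y * ∏ i, pauli (σ i) (y i) (x i) := by
  simp [Matrix.trace, Matrix.mul_apply, pauliString, tensor]

/-- A sum over strings of products over registers is a product of one-register sums. Taking κ = 1
yields Parseval, and κ = `noiseCoeff ρ` yields the noisy state. -/
theorem sum_prod_mul_trace_mul_trace (κ : Fin 4 → ℂ)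
    (A B : Matrix (Fin n → Fin 2) (Fin n → Fin 2) ℂ) :
    ∑ σ : Fin n → Fin 4, (∏ i, κ (σ i)) * ((A * pauliString σ).trace * (B * pauliString σ).trace)
      = ∑ x, ∑ y, ∑ z, ∑ w, A x y * B z w *
        ∏ i, ∑ a, κ a * (pauli a (y i) (x i) * pauli a (w i) (z i)) := by
  have hσ : ∀ σ : Fin n → Fin 4,
      (∏ i, κ (σ i)) * ((A * pauliString σ).trace * (B * pauliString σ).trace)
        = ∑ x, ∑ y, ∑ z, ∑ w, A x y * B z w *
          ∏ i, κ (σ i) * (pauli (σ i) (y i) (x i) * pauli (σ i) (w i) (z i)) := fun σ => by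
    rw [mul_comm (A * pauliString σ).trace]
    simp only [trace_mul_pauliString, Finset.mul_sum, Finset.sum_mul, Finset.prod_mul_distrib]
    exact Finset.sum_congr rfl fun x _ => Finset.sum_congr rfl fun y _ =>
      Finset.sum_congr rfl fun z _ => Finset.sum_congr rfl fun w _ => by ring
  simp only [hσ, Finset.prod_univ_sum, Fintype.piFinset_univ, Finset.mul_sum]
  rw [Finset.sum_comm]
  refine Finset.sum_congr rfl fun x _ => ?_
  rw [Finset.sum_comm]
  refine Finset.sum_congr rfl fun y _ => ?_
  rw [Finset.sum_comm]
  refine Finset.sum_congr rfl fun z _ => ?_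
  rw [Finset.sum_comm]

/-- Parseval's identity for the expansion into Pauli strings. -/
theorem sum_trace_mul_trace (A B : Matrix (Fin n → Fin 2) (Fin n → Fin 2) ℂ) :
    ∑ σ : Fin n → Fin 4, (A * pauliString σ).trace * (B * pauliString σ).trace
      = 2 ^ n * (A * B).trace := by
  have h := sum_prod_mul_trace_mul_trace (fun _ => 1) A B
  simp only [Finset.prod_const_one, one_mul, sum_pauli_mul_pauli] at h
  have hδ : ∀ x y z w : Fin n → Fin 2, (∏ i, if y i = z i ∧ x i = w i then (2 : ℂ) else 0)
      = if z = y then (if w = x then 2 ^ n else 0) else 0 := fun x y z w => by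
    split_ifs with h1 h2
    · simp [h1, h2]
    · obtain ⟨i, hi⟩ := Function.ne_iff.mp h2
      exact Finset.prod_eq_zero (Finset.mem_univ i) (if_neg fun h => hi h.2.symm)
    · obtain ⟨i, hi⟩ := Function.ne_iff.mp h1
      exact Finset.prod_eq_zero (Finset.mem_univ i) (if_neg fun h => hi h.1.symm)
  rw [h]
  simp only [hδ, mul_ite, mul_zero, Finset.sum_ite_irrel, Finset.sum_const_zero,
    Finset.sum_ite_eq', Finset.mem_univ, if_true, Matrix.trace, Matrix.diag, Matrix.mul_apply,
    Finset.mul_sum]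
  exact Finset.sum_congr rfl fun x _ => Finset.sum_congr rfl fun y _ => by ring

theorem trace_kronecker_mul_noisy (ρ : ℝ) (A B : Matrix (Fin n → Fin 2) (Fin n → Fin 2) ℂ) :
    4 ^ n * ((A ⊗ₖ B) * bipartitePower n (depolarize ρ epr)).trace
      = ∑ σ : Fin n → Fin 4, (∏ i, (noiseCoeff ρ (σ i) : ℂ))
          * ((A * pauliString σ).trace * (B * pauliString σ).trace) := by
  rw [sum_prod_mul_trace_mul_trace (fun a => (noiseCoeff ρ a : ℂ))]
  simp only [Matrix.trace, Matrix.diag, Matrix.mul_apply, Fintype.sum_prod_type,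
    Matrix.kroneckerMap_apply, bipartitePower, Matrix.submatrix_apply, tensor, Matrix.of_apply,
    Equiv.arrowProdEquivProdArrow, Equiv.coe_fn_symm_mk, depolarize_epr_apply,
    Finset.prod_mul_distrib, Finset.prod_const, Finset.card_univ, Fintype.card_fin]
  rw [Finset.mul_sum]
  refine Finset.sum_congr rfl fun x _ => ?_
  rw [Finset.sum_comm, Finset.mul_sum]
  refine Finset.sum_congr rfl fun y _ => ?_
  rw [Finset.mul_sum]
  refine Finset.sum_congr rfl fun z _ => ?_
  rw [Finset.mul_sum]
  refine Finset.sum_congr rfl fun w _ => ?_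
  have : (4 : ℂ) ^ n * (1 / 4) ^ n = 1 := by rw [← mul_pow]; norm_num
  linear_combination (A x y * B z w *
    ∏ i, ∑ a, (noiseCoeff ρ a : ℂ) * (pauli a (y i) (x i) * pauli a (w i) (z i))) * this

/-- The normalized coefficient of a matrix along a Pauli string. -/
def pauliCoeff (A : Matrix (Fin n → Fin 2) (Fin n → Fin 2) ℂ) (σ : Fin n → Fin 4) : ℝ :=
  (A * pauliString σ).trace.re / 2 ^ n

theorem trace_mul_im_eq_zero {ι : Type} [Fintype ι] {A B : Matrix ι ι ℂ} (hA : A.IsHermitian)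
    (hB : B.IsHermitian) : (A * B).trace.im = 0 := by
  have h : star (A * B).trace = (A * B).trace := by
    rw [← Matrix.trace_conjTranspose, Matrix.conjTranspose_mul, hA.eq, hB.eq,
      Matrix.trace_mul_comm]
  exact Complex.conj_eq_iff_im.mp h

theorem trace_mul_pauliString_eq {A : Matrix (Fin n → Fin 2) (Fin n → Fin 2) ℂ}
    (hA : A.IsHermitian) (σ : Fin n → Fin 4) :
    (A * pauliString σ).trace = ((2 ^ n * pauliCoeff A σ : ℝ) : ℂ) := by
  have h := trace_mul_im_eq_zero hA (B := pauliString σ) (pauliString_conjTranspose σ)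
  apply Complex.ext
  · rw [Complex.ofReal_re, pauliCoeff]; field_simp
  · rw [h, Complex.ofReal_im]

theorem sum_pauliCoeff_sq {A : Matrix (Fin n → Fin 2) (Fin n → Fin 2) ℂ}
    (hA : A.IsHermitian) : ∑ σ, pauliCoeff A σ ^ 2 = (A * A).trace.re / 2 ^ n := by
  have h := sum_trace_mul_trace A A
  simp only [trace_mul_pauliString_eq hA] at h
  have h2 := congrArg Complex.re h
  have h3 : ((2 : ℂ) ^ n * (A * A).trace).re = 2 ^ n * (A * A).trace.re := by
    rw [show (2 : ℂ) ^ n = ((2 ^ n : ℝ) : ℂ) by push_cast; rfl, Complex.re_ofReal_mul]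
  rw [h3] at h2
  simp only [← Complex.ofReal_mul, ← Complex.ofReal_sum, Complex.ofReal_re] at h2
  rw [eq_div_iff (by positivity)]
  have hN : (0 : ℝ) < 2 ^ n := by positivity
  refine mul_left_cancel₀ hN.ne' ?_
  rw [← h2, Finset.sum_mul, Finset.mul_sum]
  exact Finset.sum_congr rfl fun σ _ => by ring

theorem trace_kronecker_mul_noisyEPR {ρ : ℝ} (h0 : 0 ≤ ρ) (h1 : ρ ≤ 1)
    {A B : Matrix (Fin n → Fin 2) (Fin n → Fin 2) ℂ} (hA : A.IsHermitian) (hB : B.IsHermitian) :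
    ((A ⊗ₖ B) * (noisyEPR n ρ h0 h1).mat).trace.re
      = ∑ σ, (∏ i, noiseCoeff ρ (σ i)) * (pauliCoeff A σ * pauliCoeff B σ) := by
  have h := trace_kronecker_mul_noisy ρ A B
  simp only [trace_mul_pauliString_eq hA, trace_mul_pauliString_eq hB] at h
  have h2 := congrArg Complex.re h
  rw [show (4 : ℂ) ^ n = ((4 ^ n : ℝ) : ℂ) by push_cast; rfl, Complex.re_ofReal_mul] at h2
  simp only [← Complex.ofReal_mul, ← Complex.ofReal_prod, ← Complex.ofReal_sum,
    Complex.ofReal_re] at h2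
  have hN : (0 : ℝ) < 4 ^ n := by positivity
  refine mul_left_cancel₀ hN.ne' (h2.trans ?_)
  rw [Finset.mul_sum, show (4 : ℝ) ^ n = 2 ^ n * 2 ^ n by rw [← mul_pow]; norm_num]
  exact Finset.sum_congr rfl fun σ _ => by ring

theorem pauliCoeff_add (A B : Matrix (Fin n → Fin 2) (Fin n → Fin 2) ℂ) (σ : Fin n → Fin 4) :
    pauliCoeff (A + B) σ = pauliCoeff A σ + pauliCoeff B σ := by
  simp [pauliCoeff, Matrix.add_mul, add_div]

theorem pauliCoeff_sub (A B : Matrix (Fin n → Fin 2) (Fin n → Fin 2) ℂ) (σ : Fin n → Fin 4) :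
    pauliCoeff (A - B) σ = pauliCoeff A σ - pauliCoeff B σ := by
  simp [pauliCoeff, Matrix.sub_mul, sub_div]

theorem trace_pauliString (σ : Fin n → Fin 4) :
    (pauliString σ).trace = if σ = 0 then 2 ^ n else 0 := by
  simp only [pauliString, trace_tensor, trace_pauli]
  split_ifs with h
  · simp [h]
  · obtain ⟨i, hi⟩ := Function.ne_iff.mp h
    exact Finset.prod_eq_zero (Finset.mem_univ i) (if_neg hi)

theorem pauliCoeff_one (σ : Fin n → Fin 4) :
    pauliCoeff (1 : Matrix (Fin n → Fin 2) (Fin n → Fin 2) ℂ) σ = if σ = 0 then 1 else 0 := by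
  rw [pauliCoeff, Matrix.one_mul, trace_pauliString]
  split_ifs
  · rw [show (2 : ℂ) ^ n = ((2 ^ n : ℝ) : ℂ) by push_cast; rfl, Complex.ofReal_re]
    exact div_self (by positivity)
  · simp

theorem prod_noiseCoeff_zero (ρ : ℝ) : ∏ i, noiseCoeff ρ ((0 : Fin n → Fin 4) i) = 1 := by
  simp [noiseCoeff]

/-! ### Observables and marginals -/

theorem effect_isHermitian (E : POVM (Fin n → Fin 2)) (a : Answer) : (E.effect a).IsHermitian :=
  (E.posSemidef a).1

theorem observable_eq (E : POVM (Fin n → Fin 2)) :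
    E.observable = E.effect true - E.effect false := by
  simp [POVM.observable, Answer.value, sub_eq_add_neg]

theorem effect_add (E : POVM (Fin n → Fin 2)) : E.effect true + E.effect false = 1 := by
  simpa using E.sum_eq_one

theorem observable_isHermitian (E : POVM (Fin n → Fin 2)) : E.observable.IsHermitian := by
  rw [observable_eq]
  exact (effect_isHermitian E _).sub (effect_isHermitian E _)

/-- The two effects sum to 1 and so commute, whence the square of the observable is 1 − 4E₁E₋₁; the
product of two positive matrices has nonnegative trace. -/
theorem trace_observable_sq_le (E : POVM (Fin n → Fin 2)) :
    (E.observable * E.observable).trace.re ≤ 2 ^ n := by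
  have h := trace_mul_re_nonneg (E.posSemidef true) (E.posSemidef false)
  have h1 : E.effect false = 1 - E.effect true := by rw [← effect_add E]; abel
  have h2 : E.observable * E.observable = 1 - (4 : ℝ) • (E.effect true * E.effect false) := by
    rw [observable_eq, h1]
    simp only [Matrix.mul_sub, Matrix.sub_mul, Matrix.mul_one, Matrix.one_mul]
    module
  rw [h2, Matrix.trace_sub, Matrix.trace_smul, Matrix.trace_one, Complex.sub_re,
    Complex.smul_re, smul_eq_mul]
  simp only [Fintype.card_pi, Fintype.card_fin, Finset.prod_const, Finset.card_univ]
  rw [Complex.natCast_re]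
  push_cast
  linarith

theorem sum_pauliCoeff_observable_sq_le (E : POVM (Fin n → Fin 2)) :
    ∑ σ, pauliCoeff E.observable σ ^ 2 ≤ 1 := by
  rw [sum_pauliCoeff_sq (observable_isHermitian E), div_le_one (by positivity)]
  exact trace_observable_sq_le E

theorem pauliCoeff_zero_eq (A : Matrix (Fin n → Fin 2) (Fin n → Fin 2) ℂ) :
    pauliCoeff A 0 = A.trace.re / 2 ^ n := by
  have : pauliString (0 : Fin n → Fin 4) = 1 := by
    ext x y
    simp only [pauliString, tensor, pauli, Pi.zero_apply, Matrix.of_apply, Matrix.cons_val_zero,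
      Matrix.one_apply]
    split_ifs with h
    · simp [h]
    · obtain ⟨i, hi⟩ := Function.ne_iff.mp h
      exact Finset.prod_eq_zero (Finset.mem_univ i) (if_neg hi)
  rw [pauliCoeff, this, Matrix.mul_one]

theorem pauliCoeff_effect_zero_nonneg (E : POVM (Fin n → Fin 2)) (a : Answer) :
    0 ≤ pauliCoeff (E.effect a) 0 := by
  rw [pauliCoeff_zero_eq]
  exact div_nonneg (Complex.nonneg_iff.mp (E.posSemidef a).trace_nonneg).1 (by positivity)

theorem pauliCoeff_effect_add (E : POVM (Fin n → Fin 2)) (σ : Fin n → Fin 4) :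
    pauliCoeff (E.effect true) σ + pauliCoeff (E.effect false) σ = if σ = 0 then 1 else 0 := by
  rw [← pauliCoeff_add, effect_add, pauliCoeff_one]

variable {ρ : ℝ} (h0 : 0 ≤ ρ) (h1 : ρ ≤ 1)

/-- No signalling: Bob's effects sum to the identity, which is supported on the zero string, where
the noise factor is 1. -/
theorem sum_bob_marginal (E F : POVM (Fin n → Fin 2)) (a : Answer) :
    ∑ b, ((E.effect a ⊗ₖ F.effect b) * (noisyEPR n ρ h0 h1).mat).trace.re
      = pauliCoeff (E.effect a) 0 := by
  simp only [trace_kronecker_mul_noisyEPR h0 h1 (effect_isHermitian _ _)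
    (effect_isHermitian _ _)]
  rw [Finset.sum_comm]
  simp only [← Finset.mul_sum, Fintype.sum_bool, pauliCoeff_effect_add, mul_ite, mul_zero,
    mul_one, Finset.sum_ite_eq', Finset.mem_univ, if_true, prod_noiseCoeff_zero, one_mul]

theorem sum_alice_marginal (E F : POVM (Fin n → Fin 2)) (b : Answer) :
    ∑ a, ((E.effect a ⊗ₖ F.effect b) * (noisyEPR n ρ h0 h1).mat).trace.re
      = pauliCoeff (F.effect b) 0 := by
  simp only [trace_kronecker_mul_noisyEPR h0 h1 (effect_isHermitian _ _)
    (effect_isHermitian _ _)]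
  rw [Finset.sum_comm]
  simp only [← Finset.mul_sum, ← Finset.sum_mul, Fintype.sum_bool, pauliCoeff_effect_add, mul_ite,
    mul_zero, ite_mul, zero_mul, Finset.sum_ite_eq', Finset.mem_univ, if_true,
    prod_noiseCoeff_zero, one_mul]

/-- The centering required by `measure_frequency_ge`, for abstract correlations `G` with a marginal
`m` independent of the other player's question. -/
theorem sum_centered_alice {G : Fin 2 → Fin 2 → Bool → Bool → ℝ} {m : Bool → ℝ} {x : Fin 2}
    (hm : m true + m false = 1) (hG : ∀ y a, ∑ b, G x y a b = m a) (a : Bool) :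
    ∑ x', ∑ y, ∑ a', ∑ b, (if x' = x then (if a' = a then 1 else 0) - m a else 0)
      * (1 / 4 * G x' y a' b) = 0 := by
  rw [Finset.sum_eq_single x (fun x' _ hx => by simp [hx]) (by simp)]
  simp only [if_true, ← Finset.mul_sum, hG, Fintype.sum_bool, Finset.sum_const]
  cases a <;> simp <;> rw [← hm] <;> ring

theorem sum_centered_bob {G : Fin 2 → Fin 2 → Bool → Bool → ℝ} {m : Bool → ℝ} {x : Fin 2}
    (hm : m true + m false = 1) (hG : ∀ y b, ∑ a, G y x a b = m b) (b : Bool) :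
    ∑ y, ∑ x', ∑ a, ∑ b', (if x' = x then (if b' = b then 1 else 0) - m b else 0)
      * (1 / 4 * G y x' a b') = 0 := by
  rw [Finset.sum_comm]
  exact (Finset.sum_congr rfl fun _ _ => Finset.sum_congr rfl fun _ _ => Finset.sum_comm).trans
    (sum_centered_alice (G := fun x y b a => G y x a b) hm hG b)

theorem sum_answer_sub_mul_roundProb (S : Strategy n) (D : Player) (x : Fin 2) (a : Answer) :
    ∑ r : Round, (if r.question D = x then
      (if r.answer D = a then 1 else 0) - pauliCoeff ((S D x).effect a) 0 else 0)
      * S.roundProb (noisyEPR n ρ h0 h1) r = 0 := by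
  cases D with
  | alice =>
    have hm : ∀ y a', ∑ b, ((((S .alice x).effect a') ⊗ₖ ((S .bob y).effect b))
      * (noisyEPR n ρ h0 h1).mat).trace.re = pauliCoeff ((S .alice x).effect a') 0 :=
      fun y a' => sum_bob_marginal h0 h1 (S .alice x) (S .bob y) a'
    simp only [Fintype.sum_prod_type]
    exact sum_centered_alice (G := fun x y a b => ((((S .alice x).effect a) ⊗ₖ
      ((S .bob y).effect b)) * (noisyEPR n ρ h0 h1).mat).trace.re)
      (m := fun a => pauliCoeff ((S .alice x).effect a) 0) ((pauliCoeff_effect_add (S .alice x) 0).trans (if_pos rfl)) hm a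
  | bob =>
    have hm : ∀ x' b, ∑ a, ((((S .alice x').effect a) ⊗ₖ ((S .bob x).effect b))
      * (noisyEPR n ρ h0 h1).mat).trace.re = pauliCoeff ((S .bob x).effect b) 0 :=
      fun x' b => sum_alice_marginal h0 h1 (S .alice x') (S .bob x) b
    simp only [Fintype.sum_prod_type]
    exact sum_centered_bob (G := fun x y a b => ((((S .alice x).effect a) ⊗ₖ
      ((S .bob y).effect b)) * (noisyEPR n ρ h0 h1).mat).trace.re)
      (m := fun b => pauliCoeff ((S .bob x).effect b) 0) ((pauliCoeff_effect_add (S .bob x) 0).trans (if_pos rfl)) hm a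

/-- If the test is passed with probability `p`, the observables are almost traceless. -/
theorem pauliCoeff_obs_zero_sq_le (S : Strategy n) {t : ℕ} {p δ : ℝ} (ht : 1 ≤ t) (hp : 0 < p)
    (hδ : δ = Real.sqrt (2 * Real.log (2 / p) / t))
    (hpass : p ≤ S.passProb (noisyEPR n ρ h0 h1) t δ) (D : Player) (x : Fin 2) :
    pauliCoeff (S.obs D x) 0 ^ 2 ≤ 16 * δ ^ 2 := by
  have hE := pauliCoeff_effect_add (S D x) 0
  rw [if_pos rfl] at hE
  have hnn := pauliCoeff_effect_zero_nonneg (S D x)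
  have hq : ∀ a, 1 / 2 - 2 * δ < pauliCoeff ((S D x).effect a) 0 := fun a =>
    half_sub_lt_of_le_passProb S _ D x a (hnn a)
      (by cases a <;> linarith [hnn true, hnn false])
      (sum_answer_sub_mul_roundProb h0 h1 S D x a) ht hp hδ hpass
  rw [Strategy.obs, observable_eq, pauliCoeff_sub]
  -- The two coefficients sum to 1 and both exceed 1/2 − 2δ, so they differ by less than 4δ.
  nlinarith [hq true, hq false]

end Strings

/-! ### The low-degree part of a near-optimal strategy -/

section Levels

variable {n : ℕ}

/-- The strings with at most one Pauli matrix `X`, `Y` or `Z`. -/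
def lowStrings (n : ℕ) : Finset (Fin n → Fin 4) :=
  insert 0 (Finset.univ.image fun s : Fin n × Fin 3 => Pi.single s.1 s.2.succ)

theorem single_succ_injective : Function.Injective
    fun s : Fin n × Fin 3 => (Pi.single s.1 s.2.succ : Fin n → Fin 4) := by
  rintro ⟨k, i⟩ ⟨k', i'⟩ h
  have h1 := congrFun h k
  have hk : k = k' := by
    by_contra hk
    simp [Pi.single_eq_of_ne hk] at h1
  subst hk
  simpa using h1

theorem sum_lowStrings (F : (Fin n → Fin 4) → ℝ) :
    ∑ σ ∈ lowStrings n, F σ = F 0 + ∑ k, ∑ i : Fin 3, F (Pi.single k i.succ) := by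
  rw [lowStrings, Finset.sum_insert, Finset.sum_image single_succ_injective.injOn,
    Fintype.sum_prod_type]
  intro h
  obtain ⟨⟨k, i⟩, -, h⟩ := Finset.mem_image.mp h
  have := congrFun h k
  simp at this

theorem exists_ne_zero_of_notMem_lowStrings {σ : Fin n → Fin 4} (h : σ ∉ lowStrings n) :
    ∃ i j, i ≠ j ∧ σ i ≠ 0 ∧ σ j ≠ 0 := by
  simp only [lowStrings, Finset.mem_insert, not_or, Finset.mem_image, Finset.mem_univ, true_and,
    not_exists, Prod.forall] at h
  obtain ⟨i, hi⟩ := Function.ne_iff.mp h.1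
  obtain ⟨a, ha⟩ := Fin.exists_succ_eq.mpr hi
  obtain ⟨j, hj⟩ := Function.ne_iff.mp (h.2 i a)
  have hij : i ≠ j := by
    rintro rfl
    exact hj (by simpa using ha)
  rw [Pi.single_eq_of_ne hij.symm] at hj
  exact ⟨i, j, hij, hi, hj.symm⟩

variable {ρ : ℝ} (h0 : 0 ≤ ρ) (h1 : ρ ≤ 1)

include h0 h1 in
theorem abs_noiseCoeff_le_one (a : Fin 4) : |noiseCoeff ρ a| ≤ 1 := by
  fin_cases a <;> simp [noiseCoeff, abs_of_nonneg h0, h1]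

include h0 in
theorem abs_noiseCoeff_of_ne_zero {a : Fin 4} (ha : a ≠ 0) : |noiseCoeff ρ a| = ρ := by
  fin_cases a <;> simp [noiseCoeff, abs_of_nonneg h0] at ha ⊢

include h0 h1 in
theorem abs_prod_noiseCoeff_le {σ : Fin n → Fin 4} (h : σ ∉ lowStrings n) :
    |∏ i, noiseCoeff ρ (σ i)| ≤ ρ ^ 2 := by
  obtain ⟨i, j, hij, hi, hj⟩ := exists_ne_zero_of_notMem_lowStrings h
  rw [Finset.abs_prod, ← Finset.mul_prod_erase _ _ (Finset.mem_univ i),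
    ← Finset.mul_prod_erase _ _ (Finset.mem_erase.mpr ⟨hij.symm, Finset.mem_univ j⟩),
    abs_noiseCoeff_of_ne_zero h0 hi, abs_noiseCoeff_of_ne_zero h0 hj, ← mul_assoc, ← sq]
  exact mul_le_of_le_one_right (sq_nonneg _) (Finset.prod_le_one (fun _ _ => abs_nonneg _)
    fun _ _ => abs_noiseCoeff_le_one h0 h1 _)

/-- The sign of `Tr (σ ⊗ σ Φ)` for the Pauli matrices `σ = X, Y, Z`. -/
def eprSign : Fin 3 → ℝ := ![1, -1, 1]

theorem eprSign_sq (i : Fin 3) : eprSign i ^ 2 = 1 := by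
  fin_cases i <;> simp [eprSign]

theorem prod_noiseCoeff_single (k : Fin n) (i : Fin 3) :
    ∏ j, noiseCoeff ρ ((Pi.single k i.succ : Fin n → Fin 4) j) = ρ * eprSign i := by
  rw [Finset.prod_eq_single k (fun j _ hj => by simp [Pi.single_eq_of_ne hj, noiseCoeff])
    (by simp), Pi.single_eq_same]
  fin_cases i <;> simp [noiseCoeff, eprSign]

/-- The coefficients of `A` along the Pauli matrices acting on the register `k`. -/
def blochVec (A : Matrix (Fin n → Fin 2) (Fin n → Fin 2) ℂ) (k : Fin n) :
    EuclideanSpace ℝ (Fin 3) :=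
  WithLp.toLp 2 fun i => pauliCoeff A (Pi.single k i.succ)

/-- The coefficients of the transpose of `A` along the Pauli matrices acting on the
register `k`. -/
def blochVecT (A : Matrix (Fin n → Fin 2) (Fin n → Fin 2) ℂ) (k : Fin n) :
    EuclideanSpace ℝ (Fin 3) :=
  WithLp.toLp 2 fun i => eprSign i * pauliCoeff A (Pi.single k i.succ)

/-- Transposition reflects the Y axis, an isometry. Using it on Bob's side absorbs the sign of Y⊗Y
in Φ. -/
theorem inner_blochVecT (A B : Matrix (Fin n → Fin 2) (Fin n → Fin 2) ℂ) (k : Fin n) :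
    inner ℝ (blochVecT A k) (blochVecT B k) = inner ℝ (blochVec A k) (blochVec B k) := by
  simp only [blochVec, blochVecT, PiLp.inner_apply, RCLike.inner_apply, conj_trivial]
  exact Finset.sum_congr rfl fun i _ => by
    linear_combination pauliCoeff B (Pi.single k i.succ) * pauliCoeff A (Pi.single k i.succ)
      * eprSign_sq i

theorem norm_blochVecT (A : Matrix (Fin n → Fin 2) (Fin n → Fin 2) ℂ) (k : Fin n) :
    ‖blochVecT A k‖ = ‖blochVec A k‖ := by
  rw [norm_eq_sqrt_real_inner, norm_eq_sqrt_real_inner (blochVec A k), inner_blochVecT]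

theorem sum_norm_blochVec_sq_le (E : POVM (Fin n → Fin 2)) :
    ∑ k, ‖blochVec E.observable k‖ ^ 2 ≤ 1 := by
  refine le_trans ?_ (sum_pauliCoeff_observable_sq_le E)
  have h := sum_lowStrings fun σ => pauliCoeff E.observable σ ^ 2
  have h2 := Finset.sum_le_sum_of_subset_of_nonneg (Finset.subset_univ (lowStrings n))
    fun σ _ _ => sq_nonneg (pauliCoeff E.observable σ)
  simp only [EuclideanSpace.real_norm_sq_eq, blochVec]
  linarith [sq_nonneg (pauliCoeff E.observable 0)]

theorem violation_eq (S : Strategy n) :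
    S.violation (noisyEPR n ρ h0 h1) = ∑ σ, (∏ i, noiseCoeff ρ (σ i)) *
      (pauliCoeff (S.obs .alice 0) σ * (pauliCoeff (S.obs .bob 0) σ + pauliCoeff (S.obs .bob 1) σ)
        + pauliCoeff (S.obs .alice 1) σ
          * (pauliCoeff (S.obs .bob 0) σ - pauliCoeff (S.obs .bob 1) σ)) := by
  have hH : ∀ D x, (S.obs D x).IsHermitian := fun D x => observable_isHermitian _
  unfold Strategy.violation
  rw [Matrix.sub_mul, Matrix.add_mul, Matrix.add_mul, Matrix.trace_sub, Matrix.trace_add,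
    Matrix.trace_add, Complex.sub_re, Complex.add_re, Complex.add_re,
    trace_kronecker_mul_noisyEPR h0 h1 (hH _ _) (hH _ _),
    trace_kronecker_mul_noisyEPR h0 h1 (hH _ _) (hH _ _),
    trace_kronecker_mul_noisyEPR h0 h1 (hH _ _) (hH _ _),
    trace_kronecker_mul_noisyEPR h0 h1 (hH _ _) (hH _ _),
    ← Finset.sum_add_distrib, ← Finset.sum_add_distrib, ← Finset.sum_sub_distrib]
  exact Finset.sum_congr rfl fun σ _ => by ring

/-- Completing the squares in the CHSH expression. -/
theorem sqrt_two_mul_chsh {e : ℝ} (he : e ^ 2 = 1) (p₀ p₁ q₀ q₁ : ℝ) :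
    Real.sqrt 2 * (e * (p₀ * (q₀ + q₁) + p₁ * (q₀ - q₁)))
      = p₀ ^ 2 + p₁ ^ 2 + q₀ ^ 2 + q₁ ^ 2
        - ((p₀ - (Real.sqrt 2)⁻¹ * (e * q₀ + e * q₁)) ^ 2
          + (p₁ - (Real.sqrt 2)⁻¹ * (e * q₀ - e * q₁)) ^ 2) := by
  have h2 : Real.sqrt 2 * (Real.sqrt 2)⁻¹ = 1 := mul_inv_cancel₀ (by positivity)
  have h3 : 2 * (Real.sqrt 2)⁻¹ = Real.sqrt 2 := by
    have h : Real.sqrt 2 * Real.sqrt 2 = 2 := Real.mul_self_sqrt (by norm_num)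
    linear_combination Real.sqrt 2 * h2 - (Real.sqrt 2)⁻¹ * h
  have h4 : 2 * (Real.sqrt 2)⁻¹ ^ 2 = 1 := by rw [sq, ← mul_assoc, h3, h2]
  linear_combination (-e * (p₀ * (q₀ + q₁) + p₁ * (q₀ - q₁))) * h3
    + (e ^ 2 * (q₀ ^ 2 + q₁ ^ 2)) * h4 + (q₀ ^ 2 + q₁ ^ 2) * he

theorem abs_sqrt_two_mul_chsh_le (p₀ p₁ q₀ q₁ : ℝ) :
    |Real.sqrt 2 * (p₀ * (q₀ + q₁) + p₁ * (q₀ - q₁))| ≤ p₀ ^ 2 + p₁ ^ 2 + q₀ ^ 2 + q₁ ^ 2 := by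
  have hp := sqrt_two_mul_chsh (e := 1) (by norm_num) p₀ p₁ q₀ q₁
  have hm := sqrt_two_mul_chsh (e := -1) (by norm_num) p₀ p₁ q₀ q₁
  rw [abs_le]
  constructor <;> nlinarith [sq_nonneg (p₀ - (Real.sqrt 2)⁻¹ * (1 * q₀ + 1 * q₁)),
    sq_nonneg (p₁ - (Real.sqrt 2)⁻¹ * (1 * q₀ - 1 * q₁)),
    sq_nonneg (p₀ - (Real.sqrt 2)⁻¹ * (-1 * q₀ + -1 * q₁)),
    sq_nonneg (p₁ - (Real.sqrt 2)⁻¹ * (-1 * q₀ - -1 * q₁))]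

/-- The squared distance of Alice's Bloch vectors at the register `k` from the optimal ones
given Bob's. -/
def blochDefect (S : Strategy n) (k : Fin n) : ℝ :=
  ‖blochVec (S.obs .alice 0) k - (Real.sqrt 2)⁻¹ •
      (blochVecT (S.obs .bob 0) k + blochVecT (S.obs .bob 1) k)‖ ^ 2
    + ‖blochVec (S.obs .alice 1) k - (Real.sqrt 2)⁻¹ •
      (blochVecT (S.obs .bob 0) k - blochVecT (S.obs .bob 1) k)‖ ^ 2

theorem blochDefect_nonneg (S : Strategy n) (k : Fin n) : 0 ≤ blochDefect S k := by
  unfold blochDefect; positivity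

/-- The total weight of the four observables on the Pauli string `σ`. -/
def totalWeight (S : Strategy n) (σ : Fin n → Fin 4) : ℝ :=
  pauliCoeff (S.obs .alice 0) σ ^ 2 + pauliCoeff (S.obs .alice 1) σ ^ 2
    + pauliCoeff (S.obs .bob 0) σ ^ 2 + pauliCoeff (S.obs .bob 1) σ ^ 2

theorem totalWeight_nonneg (S : Strategy n) (σ : Fin n → Fin 4) : 0 ≤ totalWeight S σ := by
  unfold totalWeight; positivity

theorem sum_totalWeight_le (S : Strategy n) : ∑ σ, totalWeight S σ ≤ 4 := by
  have h : ∀ D x, ∑ σ, pauliCoeff (S.obs D x) σ ^ 2 ≤ 1 := fun D x =>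
    sum_pauliCoeff_observable_sq_le (S D x)
  simp only [totalWeight, Finset.sum_add_distrib]
  linarith [h .alice 0, h .alice 1, h .bob 0, h .bob 1]

/-- The total weight of the four observables on degree one. -/
def degreeOneWeight (S : Strategy n) : ℝ :=
  ∑ k, ∑ i : Fin 3, totalWeight S (Pi.single k i.succ)

theorem degreeOneWeight_eq (S : Strategy n) : degreeOneWeight S =
    ∑ k, ‖blochVec (S.obs .alice 0) k‖ ^ 2 + ∑ k, ‖blochVec (S.obs .alice 1) k‖ ^ 2
      + ∑ k, ‖blochVec (S.obs .bob 0) k‖ ^ 2 + ∑ k, ‖blochVec (S.obs .bob 1) k‖ ^ 2 := by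
  simp only [degreeOneWeight, totalWeight, Finset.sum_add_distrib, EuclideanSpace.real_norm_sq_eq,
    blochVec]

/-- The violation split by degree: 0, 1, and at least 2. Only on degree one are the completed
squares kept, as `blochDefect`. -/
theorem sqrt_two_mul_violation_le (S : Strategy n) :
    Real.sqrt 2 * S.violation (noisyEPR n ρ h0 h1) ≤ totalWeight S 0
      + ρ * (degreeOneWeight S - ∑ k, blochDefect S k)
      + ρ ^ 2 * (4 - totalWeight S 0 - degreeOneWeight S) := by
  set b : (Fin n → Fin 4) → ℝ := fun σ =>
    pauliCoeff (S.obs .alice 0) σ * (pauliCoeff (S.obs .bob 0) σ + pauliCoeff (S.obs .bob 1) σ)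
      + pauliCoeff (S.obs .alice 1) σ
        * (pauliCoeff (S.obs .bob 0) σ - pauliCoeff (S.obs .bob 1) σ) with hb
  have hbw : ∀ σ, |Real.sqrt 2 * b σ| ≤ totalWeight S σ := fun σ =>
    abs_sqrt_two_mul_chsh_le _ _ _ _
  have hv := violation_eq h0 h1 S
  rw [← Finset.sum_add_sum_compl (lowStrings n), sum_lowStrings, prod_noiseCoeff_zero] at hv
  simp only [prod_noiseCoeff_single] at hv
  have hone : Real.sqrt 2 * ∑ k, ∑ i, ρ * eprSign i * b (Pi.single k i.succ)
      = ρ * (degreeOneWeight S - ∑ k, blochDefect S k) := by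
    rw [degreeOneWeight, ← Finset.sum_sub_distrib, Finset.mul_sum, Finset.mul_sum]
    refine Finset.sum_congr rfl fun k _ => ?_
    simp only [blochDefect, EuclideanSpace.real_norm_sq_eq, blochVec, blochVecT,
      ← Finset.sum_add_distrib, ← Finset.sum_sub_distrib, Finset.mul_sum]
    refine Finset.sum_congr rfl fun i _ => ?_
    have h := sqrt_two_mul_chsh (eprSign_sq i) (pauliCoeff (S.obs .alice 0) (Pi.single k i.succ))
      (pauliCoeff (S.obs .alice 1) (Pi.single k i.succ))
      (pauliCoeff (S.obs .bob 0) (Pi.single k i.succ))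
      (pauliCoeff (S.obs .bob 1) (Pi.single k i.succ))
    simp only [PiLp.sub_apply, PiLp.smul_apply, PiLp.add_apply, smul_eq_mul, totalWeight]
    rw [← h]
    ring
  have hrest : Real.sqrt 2 * ∑ σ ∈ (lowStrings n)ᶜ, (∏ i, noiseCoeff ρ (σ i)) * b σ
      ≤ ρ ^ 2 * (4 - totalWeight S 0 - degreeOneWeight S) := by
    have htot := sum_totalWeight_le S
    rw [← Finset.sum_add_sum_compl (lowStrings n), sum_lowStrings] at htot
    calc _ = ∑ σ ∈ (lowStrings n)ᶜ, (∏ i, noiseCoeff ρ (σ i)) * (Real.sqrt 2 * b σ) := by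
          rw [Finset.mul_sum]
          exact Finset.sum_congr rfl fun σ _ => by ring
      _ ≤ ∑ σ ∈ (lowStrings n)ᶜ, ρ ^ 2 * totalWeight S σ := by
          refine Finset.sum_le_sum fun σ hσ => (le_abs_self _).trans ?_
          rw [abs_mul]
          exact mul_le_mul (abs_prod_noiseCoeff_le h0 h1 (Finset.mem_compl.mp hσ)) (hbw σ)
            (abs_nonneg _) (sq_nonneg _)
      _ = ρ ^ 2 * ∑ σ ∈ (lowStrings n)ᶜ, totalWeight S σ := (Finset.mul_sum _ _ _).symm
      _ ≤ _ := by
          refine mul_le_mul_of_nonneg_left ?_ (sq_nonneg _)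
          rw [degreeOneWeight]
          linarith
  rw [hv, mul_add, mul_add, one_mul, hone]
  linarith [(le_abs_self _).trans (hbw 0)]

/-- A near-optimal strategy has almost all of its weight on degree one, where it almost
satisfies the relations of an optimal strategy. -/
theorem degreeOne_of_violation (S : Strategy n) {ε η : ℝ} (hρ : 0 < ρ) (hρ1 : ρ < 1)
    (hw : totalWeight S 0 + Real.sqrt 2 * ε ≤ ρ * (1 - ρ) * η)
    (hη : 0 ≤ η)
    (hv : 2 * Real.sqrt 2 * ρ - ε ≤ S.violation (noisyEPR n ρ h0 h1)) :
    (∀ D x, 1 - η ≤ ∑ k, ‖blochVec (S.obs D x) k‖ ^ 2) ∧ ∀ k, blochDefect S k ≤ η := by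
  have hv2 := mul_le_mul_of_nonneg_left hv (Real.sqrt_nonneg 2)
  have h2 : Real.sqrt 2 * Real.sqrt 2 = 2 := Real.mul_self_sqrt (by norm_num)
  have hv3 : 4 * ρ - Real.sqrt 2 * ε ≤ Real.sqrt 2 * S.violation (noisyEPR n ρ h0 h1) := by
    linear_combination hv2 - 2 * ρ * h2
  have hv4 := hv3.trans (sqrt_two_mul_violation_le h0 h1 S)
  have hD : 0 ≤ ∑ k, blochDefect S k := Finset.sum_nonneg fun k _ => blochDefect_nonneg S k
  have hle : ∀ D x, ∑ k, ‖blochVec (S.obs D x) k‖ ^ 2 ≤ 1 := fun D x =>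
    sum_norm_blochVec_sq_le (S D x)
  have hdeg := degreeOneWeight_eq S
  have hT := totalWeight_nonneg S 0
  have hdeg4 : degreeOneWeight S ≤ 4 := by
    rw [hdeg]
    linarith [hle .alice 0, hle .alice 1, hle .bob 0, hle .bob 1]
  -- With W₀ and W₁ the weights on degrees zero and one, this is a rearrangement of 4ρ − √2ε ≤ W₀ +
  -- ρ(W₁ − D) + ρ²(4 − W₀ − W₁), dropping −ρ²W₀. The gap ρ − ρ² is the source of the factor 1/(1 −
  -- ρ).
  have key : ρ * (1 - ρ) * (4 - degreeOneWeight S) + ρ * ∑ k, blochDefect S k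
      ≤ totalWeight S 0 + Real.sqrt 2 * ε := by
    nlinarith [mul_nonneg (sq_nonneg ρ) hT]
  constructor
  · have hpos : 0 < ρ * (1 - ρ) := mul_pos hρ (by linarith)
    -- Each of the four observables has degree-one weight at most 1, so a total of at least 4 − η
    -- leaves each at least 1 − η.
    have h3 : 4 - degreeOneWeight S ≤ η := by
      refine le_of_mul_le_mul_left ?_ hpos
      linarith [mul_nonneg hρ.le hD]
    rw [hdeg] at h3
    intro D x
    have e1 := hle .alice 0
    have e2 := hle .alice 1
    have e3 := hle .bob 0
    have e4 := hle .bob 1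
    cases D <;> fin_cases x <;> simp only [Fin.zero_eta, Fin.mk_one] <;> linarith
  · intro k
    have h4 : ρ * ∑ k, blochDefect S k ≤ ρ * η := by
      linarith [mul_nonneg (mul_nonneg h0 (sub_nonneg.2 h1)) (sub_nonneg.2 hdeg4),
        mul_nonneg (mul_nonneg h0 h0) hη]
    exact (Finset.single_le_sum (fun k _ => blochDefect_nonneg S k) (Finset.mem_univ k)).trans
      (le_of_mul_le_mul_left h4 hρ)

end Levels

/-! ### One-qubit observables and unitaries -/

/-- The one-qubit matrix `u₀ X + u₁ Y + u₂ Z`. -/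
def bloch (u : EuclideanSpace ℝ (Fin 3)) : Matrix (Fin 2) (Fin 2) ℂ :=
  ∑ i : Fin 3, (u i : ℂ) • pauli i.succ

theorem bloch_eq (u : EuclideanSpace ℝ (Fin 3)) :
    bloch u = !![(u 2 : ℂ), u 0 - u 1 * Complex.I; u 0 + u 1 * Complex.I, -u 2] := by
  ext i j
  rw [bloch, Fin.sum_univ_three]
  fin_cases i <;> fin_cases j <;> simp [pauli, pauliX, pauliZ]
  ring

theorem bloch_isHermitian (u : EuclideanSpace ℝ (Fin 3)) : (bloch u).IsHermitian := by
  rw [bloch_eq]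
  ext i j
  fin_cases i <;> fin_cases j <;> simp [Matrix.conjTranspose_apply, sub_eq_add_neg]

/-- The Clifford relation: unit vectors give involutions, and orthogonal vectors give anticommuting
matrices. -/
theorem bloch_mul_add_mul (u w : EuclideanSpace ℝ (Fin 3)) :
    bloch u * bloch w + bloch w * bloch u = ((2 * inner ℝ u w : ℝ) : ℂ) • 1 := by
  have h : inner ℝ u w = u 0 * w 0 + u 1 * w 1 + u 2 * w 2 := by
    simp only [PiLp.inner_apply, RCLike.inner_apply, conj_trivial, Fin.sum_univ_three]
    ring
  have hI := Complex.I_sq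
  rw [h, bloch_eq, bloch_eq]
  ext i j
  fin_cases i <;> fin_cases j <;> simp
  · linear_combination (-2 * (u 1 : ℂ) * w 1) * hI
  · ring
  · ring
  · linear_combination (-2 * (u 1 : ℂ) * w 1) * hI

theorem bloch_mul_self {u : EuclideanSpace ℝ (Fin 3)} (hu : ‖u‖ = 1) :
    bloch u * bloch u = 1 := by
  have h := bloch_mul_add_mul u u
  rw [real_inner_self_eq_norm_sq, hu, ← two_smul ℂ] at h
  have h2 : (2 : ℂ) • (bloch u * bloch u) = (2 : ℂ) • 1 := by simpa using h
  exact smul_right_injective _ two_ne_zero h2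

theorem isTracelessObservable_bloch {u : EuclideanSpace ℝ (Fin 3)} (hu : ‖u‖ = 1) :
    IsTracelessObservable (bloch u) where
  isHermitian := bloch_isHermitian u
  sq_eq_one := bloch_mul_self hu
  trace_eq_zero := by simp [bloch_eq, Matrix.trace_fin_two]

/-- Two anticommuting one-qubit observables are simultaneously conjugate to `Z` and `X`. -/
theorem exists_unitary_of_anticommute {A B : Matrix (Fin 2) (Fin 2) ℂ} (hA : A.IsHermitian)
    (hB : B.IsHermitian) (hA2 : A * A = 1) (hB2 : B * B = 1) (hAB : A * B + B * A = 0) :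
    ∃ V ∈ Matrix.unitaryGroup (Fin 2) ℂ,
      V * pauliZ * V.conjTranspose = A ∧ V * pauliX * V.conjTranspose = B := by
  obtain ⟨e, he1, heA⟩ : ∃ e : Fin 2 → ℂ, star e ⬝ᵥ e = 1 ∧ A.mulVec e = e := by
    -- If A = −1, anticommutation would force B = 0. Otherwise any nonzero vector in the range of A
    -- + 1 is fixed by A, because A² = 1.
    have hne : A + 1 ≠ 0 := by
      intro h
      have hA1 : A = -1 := eq_neg_of_add_eq_zero_left h
      have hB0 : (2 : ℂ) • B = 0 := by
        rw [hA1] at hAB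
        have h3 : -((2 : ℂ) • B) = 0 := by
          rw [← hAB, two_smul]; simp
        simpa using h3
      have hB0 : B = 0 := by simpa using hB0
      rw [hB0] at hB2
      simp at hB2
    obtain ⟨v, hv⟩ : ∃ v, (A + 1).mulVec v ≠ 0 := by
      by_contra! hcon
      exact hne (Matrix.ext_of_mulVec_single fun i => by rw [hcon, Matrix.zero_mulVec])
    set c := (A + 1).mulVec v
    have hc : A.mulVec c = c := by
      rw [Matrix.mulVec_mulVec, Matrix.mul_add, hA2, Matrix.mul_one, add_comm]
    have hpos : 0 < star c ⬝ᵥ c := Matrix.dotProduct_star_self_pos_iff.mpr hv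
    obtain ⟨hre, him⟩ := Complex.pos_iff.mp hpos
    set r : ℝ := (star c ⬝ᵥ c).re
    have hr : star c ⬝ᵥ c = (r : ℂ) := Complex.ext rfl (by rw [← him, Complex.ofReal_im])
    refine ⟨((Real.sqrt r)⁻¹ : ℂ) • c, ?_, by rw [Matrix.mulVec_smul, hc]⟩
    rw [star_smul, smul_dotProduct, dotProduct_smul, hr]
    have hs : ((Real.sqrt r : ℝ) : ℂ) * (Real.sqrt r : ℝ) = r := by
      rw [← Complex.ofReal_mul, Real.mul_self_sqrt hre.le]
    have hs0 : ((Real.sqrt r : ℝ) : ℂ) ≠ 0 :=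
      Complex.ofReal_ne_zero.mpr (Real.sqrt_pos.mpr hre).ne'
    simp only [smul_eq_mul, star_inv₀, Complex.star_def, Complex.conj_ofReal]
    rw [← hs]
    field_simp
  -- B exchanges the ±1 eigenspaces of A, so the columns e and Be form a basis in which A and B
  -- become Z and X.
  set f := B.mulVec e with hf
  have hBf : B.mulVec f = e := by rw [hf, Matrix.mulVec_mulVec, hB2, Matrix.one_mulVec]
  have hAf : A.mulVec f = -f := by
    rw [hf, Matrix.mulVec_mulVec, eq_neg_of_add_eq_zero_left hAB, Matrix.neg_mulVec,
      ← Matrix.mulVec_mulVec, heA]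
  have hadj : ∀ {M : Matrix (Fin 2) (Fin 2) ℂ}, M.IsHermitian → ∀ x y : Fin 2 → ℂ,
      star (M.mulVec x) ⬝ᵥ y = star x ⬝ᵥ M.mulVec y := fun {M} hM x y => by
    rw [Matrix.star_mulVec, hM.eq, Matrix.dotProduct_mulVec]
  have hff : star f ⬝ᵥ f = 1 := by
    conv_lhs => rw [hf]
    rw [hadj hB, ← hf, hBf, he1]
  have hef : star e ⬝ᵥ f = 0 := by
    have h1 := hadj hA e f
    rw [heA, hAf, dotProduct_neg] at h1
    exact self_eq_neg.mp h1
  have hfe : star f ⬝ᵥ e = 0 := by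
    rw [Matrix.star_dotProduct, hef, star_zero]
  set V : Matrix (Fin 2) (Fin 2) ℂ := Matrix.of fun i j => ![e i, f i] j with hV
  have hVV : V.conjTranspose * V = 1 := by
    ext i j
    simp only [dotProduct, Fin.sum_univ_two, Pi.star_apply] at he1 hff hef hfe
    fin_cases i <;> fin_cases j <;>
      simp [hV, Matrix.mul_apply, Matrix.conjTranspose_apply] <;> assumption
  have hVV' : V * V.conjTranspose = 1 := mul_eq_one_comm.mp hVV
  have hAV : A * V = V * pauliZ := by
    ext i j
    have h1 := congrFun heA i
    have h2 := congrFun hAf i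
    simp only [Matrix.mulVec, dotProduct, Fin.sum_univ_two, Pi.neg_apply] at h1 h2
    fin_cases j <;> simp [hV, Matrix.mul_apply, Fin.sum_univ_two, pauliZ, h1, h2]
  have hBV : B * V = V * pauliX := by
    ext i j
    have h1 := congrFun hf i
    have h2 := congrFun hBf i
    simp only [Matrix.mulVec, dotProduct, Fin.sum_univ_two] at h1 h2
    fin_cases j <;> simp [hV, Matrix.mul_apply, Fin.sum_univ_two, pauliX, h1, h2]
  refine ⟨V, Matrix.mem_unitaryGroup_iff.mpr hVV', ?_, ?_⟩
  · rw [← hAV, Matrix.mul_assoc, hVV', Matrix.mul_one]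
  · rw [← hBV, Matrix.mul_assoc, hVV', Matrix.mul_one]

theorem exists_unitary_bloch {a b : EuclideanSpace ℝ (Fin 3)} (ha : ‖a‖ = 1) (hb : ‖b‖ = 1)
    (hab : inner ℝ a b = 0) : ∃ V ∈ Matrix.unitaryGroup (Fin 2) ℂ,
      V * pauliZ * V.conjTranspose = bloch a ∧ V * pauliX * V.conjTranspose = bloch b :=
  exists_unitary_of_anticommute (bloch_isHermitian a) (bloch_isHermitian b) (bloch_mul_self ha)
    (bloch_mul_self hb) (by rw [bloch_mul_add_mul, hab]; simp)

theorem exists_orthogonal_unit {a : EuclideanSpace ℝ (Fin 3)} (ha : ‖a‖ = 1) :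
    ∃ b : EuclideanSpace ℝ (Fin 3), ‖b‖ = 1 ∧ inner ℝ a b = 0 := by
  have hon : Orthonormal ℝ (({0} : Set (Fin 3)).domRestrict fun _ => a) := by
    constructor
    · exact fun _ => ha
    · intro i j hij
      exact absurd (Subsingleton.elim i j) hij
  obtain ⟨b, hb⟩ := hon.exists_orthonormalBasis_extension_of_card_eq (by simp)
  refine ⟨b 1, b.orthonormal.1 1, ?_⟩
  rw [← hb 0 rfl]
  exact b.orthonormal.2 (by decide)

theorem exists_unit_inner_eq_norm (v : EuclideanSpace ℝ (Fin 3)) :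
    ∃ u : EuclideanSpace ℝ (Fin 3), ‖u‖ = 1 ∧ inner ℝ u v = ‖v‖ := by
  by_cases hv : v = 0
  · exact ⟨EuclideanSpace.single 0 1, by simp, by simp [hv]⟩
  · refine ⟨‖v‖⁻¹ • v, norm_smul_inv_norm hv, ?_⟩
    have : ‖v‖ ≠ 0 := norm_ne_zero_iff.mpr hv
    rw [real_inner_smul_left, real_inner_self_eq_norm_sq]
    field_simp

/-! ### Matrices acting on one register -/

section Register

variable {n : ℕ}

theorem onRegister_apply (k : Fin n) (M : Matrix (Fin 2) (Fin 2) ℂ) (x y : Fin n → Fin 2) :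
    onRegister k M x y = M (x k) (y k) *
      ∏ i ∈ Finset.univ.erase k, (1 : Matrix (Fin 2) (Fin 2) ℂ) (x i) (y i) := by
  simp only [onRegister, tensor, Matrix.of_apply]
  rw [← Finset.mul_prod_erase _ _ (Finset.mem_univ k), Function.update_self]
  congr 1
  exact Finset.prod_congr rfl fun i hi => by
    rw [Function.update_of_ne (Finset.ne_of_mem_erase hi)]

theorem tensor_one : tensor (fun _ : Fin n => (1 : Matrix (Fin 2) (Fin 2) ℂ)) = 1 := by
  ext x y
  simp only [tensor, Matrix.of_apply, Matrix.one_apply]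
  split_ifs with h
  · simp [h]
  · obtain ⟨i, hi⟩ := Function.ne_iff.mp h
    exact Finset.prod_eq_zero (Finset.mem_univ i) (if_neg hi)

theorem onRegister_mul (k : Fin n) (M N : Matrix (Fin 2) (Fin 2) ℂ) :
    onRegister k M * onRegister k N = onRegister k (M * N) := by
  rw [onRegister, onRegister, tensor_mul, onRegister]
  congr 1
  ext1 i
  by_cases h : i = k
  · subst h; simp
  · simp [Function.update_of_ne h]

theorem onRegister_conjTranspose (k : Fin n) (M : Matrix (Fin 2) (Fin 2) ℂ) :
    (onRegister k M).conjTranspose = onRegister k M.conjTranspose := by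
  rw [onRegister, conjTranspose_tensor, onRegister]
  congr 1
  ext1 i
  by_cases h : i = k
  · subst h; simp
  · simp [Function.update_of_ne h]

theorem onRegister_one (k : Fin n) : onRegister k 1 = 1 := by
  rw [onRegister, ← tensor_one]
  congr 1
  exact Function.update_eq_self k fun _ => 1

theorem onRegister_isHermitian (k : Fin n) {M : Matrix (Fin 2) (Fin 2) ℂ}
    (hM : M.IsHermitian) : (onRegister k M).IsHermitian := by
  rw [Matrix.IsHermitian, onRegister_conjTranspose, hM.eq]

theorem onRegister_bloch (k : Fin n) (u : EuclideanSpace ℝ (Fin 3)) :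
    onRegister k (bloch u) = ∑ i : Fin 3, (u i : ℂ) • onRegister k (pauli i.succ) := by
  ext x y
  simp only [Matrix.sum_apply, Matrix.smul_apply, onRegister_apply, bloch, Finset.sum_mul,
    smul_eq_mul, mul_assoc]

theorem pauliString_single (k : Fin n) (a : Fin 4) :
    pauliString (Pi.single k a) = onRegister k (pauli a) := by
  rw [pauliString, onRegister]
  congr 1
  ext1 i
  by_cases h : i = k
  · subst h; simp
  · simp [Function.update_of_ne h, Pi.single_eq_of_ne h, pauli]

theorem trace_mul_onRegister_bloch (A : Matrix (Fin n → Fin 2) (Fin n → Fin 2) ℂ) (k : Fin n)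
    (u : EuclideanSpace ℝ (Fin 3)) :
    (A * onRegister k (bloch u)).trace.re = 2 ^ n * inner ℝ u (blochVec A k) := by
  rw [onRegister_bloch, Matrix.mul_sum, Matrix.trace_sum, Complex.re_sum]
  simp only [PiLp.inner_apply, RCLike.inner_apply, conj_trivial, blochVec, Finset.mul_sum]
  refine Finset.sum_congr rfl fun i _ => ?_
  rw [Matrix.mul_smul, Matrix.trace_smul, smul_eq_mul, Complex.re_ofReal_mul, pauliCoeff,
    pauliString_single]
  field_simp

theorem onRegister_pauliZ (k : Fin n) :
    onRegister k pauliZ = Matrix.diagonal fun x : Fin n → Fin 2 => (bitSign (x k) : ℂ) := by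
  have hZ : ∀ a b : Fin 2, pauliZ a b = if a = b then (bitSign a : ℂ) else 0 := fun a b => by
    fin_cases a <;> fin_cases b <;> simp [pauliZ, bitSign]
  ext x y
  rw [onRegister_apply, Matrix.diagonal_apply, hZ]
  by_cases h : x = y
  · subst h
    simp [Matrix.one_apply_eq]
  · rw [if_neg h]
    obtain ⟨i, hi⟩ := Function.ne_iff.mp h
    by_cases hk : i = k
    · subst hk
      rw [if_neg hi, zero_mul]
    · have h1 : (1 : Matrix (Fin 2) (Fin 2) ℂ) (x i) (y i) = 0 := Matrix.one_apply_ne hi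
      rw [Finset.prod_eq_zero (i := i) (Finset.mem_erase.mpr ⟨hk, Finset.mem_univ i⟩) h1, mul_zero]

theorem tensor_mul_onRegister_mul (V : Fin n → Matrix (Fin 2) (Fin 2) ℂ)
    (hV : ∀ i, V i * (V i).conjTranspose = 1) (k : Fin n) (M : Matrix (Fin 2) (Fin 2) ℂ) :
    tensor V * onRegister k M * (tensor V).conjTranspose
      = onRegister k (V k * M * (V k).conjTranspose) := by
  rw [onRegister, conjTranspose_tensor, tensor_mul, tensor_mul, onRegister]
  congr 1
  ext1 i
  by_cases h : i = k
  · subst h; simp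
  · simp [Function.update_of_ne h, hV]

/-- An observable whose weight on degree one is close to `1` has a single register that carries
almost all of this weight. -/
theorem exists_dominant_register (hn : 1 ≤ n) (E : POVM (Fin n → Fin 2)) :
    ∃ k, 1 - 14 * (1 - ∑ k, ‖blochVec E.observable k‖ ^ 2)
      ≤ ‖blochVec E.observable k‖ ^ 2 := by
  -- A local rotation aligns each Bloch vector with Z. The diagonal of the rotated observable is
  -- then a [−1,1]-valued function whose degree-one Fourier coefficients are the norms of the Bloch
  -- vectors.
  have hex : ∀ k, ∃ V ∈ Matrix.unitaryGroup (Fin 2) ℂ, ∃ u : EuclideanSpace ℝ (Fin 3),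
      V * pauliZ * V.conjTranspose = bloch u ∧
      inner ℝ u (blochVec E.observable k) = ‖blochVec E.observable k‖ := fun k => by
    obtain ⟨u, hu, huv⟩ := exists_unit_inner_eq_norm (blochVec E.observable k)
    obtain ⟨w, hw, huw⟩ := exists_orthogonal_unit hu
    obtain ⟨V, hV, hVZ, -⟩ := exists_unitary_bloch hu hw huw
    exact ⟨V, hV, u, hVZ, huv⟩
  choose V hV u hVZ huv using hex
  have hVr : ∀ i, V i * (V i).conjTranspose = 1 := fun i =>
    Matrix.mem_unitaryGroup_iff.mp (hV i)
  have hVl : (tensor V).conjTranspose * tensor V = 1 := by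
    rw [conjTranspose_tensor, tensor_mul, ← tensor_one]
    exact congrArg tensor (funext fun i => Matrix.mem_unitaryGroup_iff'.mp (hV i))
  set W := tensor V with hW
  refine exists_dominant_coordinate (l := fun k => ‖blochVec E.observable k‖)
    (f := fun x => ((W.conjTranspose * E.observable * W) x x).re) hn ?_ ?_
    (sum_norm_blochVec_sq_le E)
  · intro x
    have hpos : ∀ a, 0 ≤ ((W.conjTranspose * E.effect a * W) x x).re := fun a =>
      (Complex.nonneg_iff.mp ((E.posSemidef a).conjTranspose_mul_mul_same W).diag_nonneg).1
    have hsum : ((W.conjTranspose * E.effect true * W) x x).re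
        + ((W.conjTranspose * E.effect false * W) x x).re = 1 := by
      rw [← Complex.add_re, ← Matrix.add_apply, ← Matrix.add_mul, ← Matrix.mul_add, effect_add,
        Matrix.mul_one, hVl, Matrix.one_apply_eq, Complex.one_re]
    rw [observable_eq, Matrix.mul_sub, Matrix.sub_mul, Matrix.sub_apply, Complex.sub_re, abs_le]
    constructor <;> linarith [hpos true, hpos false]
  · intro k
    have h1 : ∑ x, ((W.conjTranspose * E.observable * W) x x).re * bitSign (x k)
        = (W.conjTranspose * E.observable * W * onRegister k pauliZ).trace.re := by
      rw [onRegister_pauliZ, Matrix.trace, Complex.re_sum]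
      refine Finset.sum_congr rfl fun x _ => ?_
      rw [Matrix.diag_apply, Matrix.mul_diagonal, mul_comm _ ((bitSign (x k) : ℝ) : ℂ),
        Complex.re_ofReal_mul, mul_comm]
    have h2 : (W.conjTranspose * E.observable * W * onRegister k pauliZ).trace
        = (E.observable * (W * onRegister k pauliZ * W.conjTranspose)).trace := by
      rw [Matrix.mul_assoc, Matrix.mul_assoc, Matrix.trace_mul_comm]
      simp only [Matrix.mul_assoc]
    rw [h1, h2, hW, tensor_mul_onRegister_mul V hVr, hVZ, trace_mul_onRegister_bloch, huv, mul_comm]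

/-- Expand the square: both normalized squared norms are at most 1 and the correlation is at least
c. -/
theorem normF_sub_le {A B : Matrix (Fin n → Fin 2) (Fin n → Fin 2) ℂ} (hA : A.IsHermitian)
    (hB : B.IsHermitian) (hA2 : (A * A).trace.re ≤ 2 ^ n) (hB2 : (B * B).trace.re ≤ 2 ^ n)
    {c : ℝ} (hc : 2 ^ n * c ≤ (A * B).trace.re) : normF (A - B) ≤ Real.sqrt (2 - 2 * c) := by
  unfold normF
  refine Real.sqrt_le_sqrt ?_
  have hcard : ((Fintype.card (Fin n → Fin 2) : ℕ) : ℝ) = 2 ^ n := by simp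
  rw [hcard, div_le_iff₀ (by positivity), Matrix.conjTranspose_sub, hA.eq, hB.eq, Matrix.mul_sub,
    Matrix.sub_mul, Matrix.sub_mul, Matrix.trace_sub, Matrix.trace_sub, Matrix.trace_sub,
    Matrix.trace_mul_comm B A]
  simp only [Complex.sub_re]
  linarith

theorem trace_onRegister_mul_self (k : Fin n) {M : Matrix (Fin 2) (Fin 2) ℂ} (hM : M * M = 1) :
    (onRegister k M * onRegister k M).trace.re ≤ 2 ^ n := by
  rw [onRegister_mul, hM, onRegister_one, Matrix.trace_one, Complex.natCast_re]
  simp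

theorem normF_observable_sub_le (E : POVM (Fin n → Fin 2)) (k : Fin n)
    {a : EuclideanSpace ℝ (Fin 3)} (ha : ‖a‖ = 1) {c : ℝ}
    (hc : c ≤ inner ℝ a (blochVec E.observable k)) :
    normF (E.observable - onRegister k (bloch a)) ≤ Real.sqrt (2 - 2 * c) := by
  refine normF_sub_le (observable_isHermitian E) (onRegister_isHermitian k (bloch_isHermitian a))
    (trace_observable_sq_le E) (trace_onRegister_mul_self k (bloch_mul_self ha)) ?_
  rw [trace_mul_onRegister_bloch]
  gcongr

theorem normF_conj (k : Fin n) {V : Matrix (Fin 2) (Fin 2) ℂ}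
    (hV : V ∈ Matrix.unitaryGroup (Fin 2) ℂ) (M : Matrix (Fin 2) (Fin 2) ℂ)
    (A : Matrix (Fin n → Fin 2) (Fin n → Fin 2) ℂ) :
    normF (onRegister k V.conjTranspose * A * (onRegister k V.conjTranspose).conjTranspose
      - onRegister k M) = normF (A - onRegister k (V * M * V.conjTranspose)) := by
  have h1 : V * V.conjTranspose = 1 := Matrix.mem_unitaryGroup_iff.mp hV
  have h2 : V.conjTranspose * V = 1 := Matrix.mem_unitaryGroup_iff'.mp hV
  set U := onRegister k V.conjTranspose with hU
  have hUH : U.conjTranspose = onRegister k V := by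
    rw [hU, onRegister_conjTranspose, Matrix.conjTranspose_conjTranspose]
  have hUU : U * U.conjTranspose = 1 := by rw [hUH, hU, onRegister_mul, h2, onRegister_one]
  have hUU' : U.conjTranspose * U = 1 := by rw [hUH, hU, onRegister_mul, h1, onRegister_one]
  have hM : onRegister k (V * M * V.conjTranspose) = U.conjTranspose * onRegister k M * U := by
    rw [hUH, hU, onRegister_mul, onRegister_mul]
  have hsub : U * A * U.conjTranspose - onRegister k M
      = U * (A - onRegister k (V * M * V.conjTranspose)) * U.conjTranspose := by
    rw [hM, Matrix.mul_sub, Matrix.sub_mul]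
    congr 1
    simp only [← Matrix.mul_assoc, hUU, Matrix.one_mul]
    rw [Matrix.mul_assoc, hUU, Matrix.mul_one]
  rw [hsub]
  set D := A - onRegister k (V * M * V.conjTranspose)
  unfold normF
  congr 3
  rw [Matrix.conjTranspose_mul, Matrix.conjTranspose_mul, Matrix.conjTranspose_conjTranspose]
  calc (U * D * U.conjTranspose * (U * (D.conjTranspose * U.conjTranspose))).trace
      = (U * (D * (U.conjTranspose * U) * D.conjTranspose * U.conjTranspose)).trace := by
        simp only [Matrix.mul_assoc]
    _ = (D * D.conjTranspose).trace := by
        rw [Matrix.trace_mul_comm, hUU', Matrix.mul_one, Matrix.mul_assoc, hUU', Matrix.mul_one]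

/-- Two observables with almost orthonormal Bloch vectors at the register `k` are jointly
conjugate, approximately, to `Z` and `X` on this register. -/
theorem exists_unitary_register (E₀ E₁ : POVM (Fin n → Fin 2)) (k : Fin n)
    {a b : EuclideanSpace ℝ (Fin 3)} (ha : ‖a‖ = 1) (hb : ‖b‖ = 1) (hab : inner ℝ a b = 0)
    {c : ℝ} (hca : c ≤ inner ℝ a (blochVec E₀.observable k))
    (hcb : c ≤ inner ℝ b (blochVec E₁.observable k)) :
    ∃ U ∈ Matrix.unitaryGroup (Fin 2) ℂ,
      normF (onRegister k U * E₀.observable * (onRegister k U).conjTranspose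
        - onRegister k pauliZ) ≤ Real.sqrt (2 - 2 * c) ∧
      normF (onRegister k U * E₁.observable * (onRegister k U).conjTranspose
        - onRegister k pauliX) ≤ Real.sqrt (2 - 2 * c) := by
  obtain ⟨V, hV, hZ, hX⟩ := exists_unitary_bloch ha hb hab
  refine ⟨V.conjTranspose, Unitary.star_mem hV, ?_, ?_⟩
  · rw [normF_conj k hV, hZ]
    exact normF_observable_sub_le E₀ k ha hca
  · rw [normF_conj k hV, hX]
    exact normF_observable_sub_le E₁ k hb hcb

end Register

/-! ### Geometry of near-optimal Bloch vectors -/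

section Geometry

variable {V : Type*} [NormedAddCommGroup V]

/-- Two distinct such registers would carry weight above 16e² + 1 − 14e² ≥ 1. -/
theorem eq_of_norm_sq_large {n : ℕ} {v : Fin n → V} {e : ℝ}
    (hsum : ∑ k, ‖v k‖ ^ 2 ≤ 1) {i : Fin n} (hi : 1 - 14 * e ^ 2 ≤ ‖v i‖ ^ 2)
    (he0 : 0 ≤ e) {j : Fin n} (hj : 4 * e < ‖v j‖) : j = i := by
  by_contra hij
  have h := Finset.add_le_sum (f := fun k => ‖v k‖ ^ 2) (fun k _ => sq_nonneg _)
    (Finset.mem_univ j) (Finset.mem_univ i) hij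
  nlinarith

theorem norm_le_one_of_sum {n : ℕ} {v : Fin n → V} (hsum : ∑ k, ‖v k‖ ^ 2 ≤ 1) (k : Fin n) :
    ‖v k‖ ≤ 1 := by
  have h := Finset.single_le_sum (f := fun k => ‖v k‖ ^ 2) (fun k _ => sq_nonneg _)
    (Finset.mem_univ k)
  have h2 : ‖v k‖ ^ 2 ≤ 1 := h.trans hsum
  nlinarith [norm_nonneg (v k)]

variable [InnerProductSpace ℝ V]

theorem sqrt_two_inv_bounds :
    7 / 10 ≤ (Real.sqrt 2)⁻¹ ∧ (Real.sqrt 2)⁻¹ ≤ 71 / 100 ∧ (Real.sqrt 2)⁻¹ ^ 2 = 1 / 2 := by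
  have h : (Real.sqrt 2)⁻¹ ^ 2 = 1 / 2 := by
    rw [inv_pow, Real.sq_sqrt (by norm_num)]; norm_num
  have h0 : 0 ≤ (Real.sqrt 2)⁻¹ := by positivity
  exact ⟨by nlinarith, by nlinarith, h⟩

/-- If `p₀, p₁` are close to the images of `q₀, q₁` under the Hadamard rotation, then
the scalar product of `p₀` and `p₁` is small. -/
theorem abs_inner_le_of_hadamard {p₀ p₁ q₀ q₁ : V} {e : ℝ} (he0 : 0 ≤ e) (he : e ≤ 1 / 20)
    (hp₀ : ‖p₀‖ ≤ 1) (hq₀ : ‖q₀‖ ≤ 1) (hq₁ : ‖q₁‖ ≤ 1)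
    (hq₀' : 1 - 14 * e ^ 2 ≤ ‖q₀‖ ^ 2) (hq₁' : 1 - 14 * e ^ 2 ≤ ‖q₁‖ ^ 2)
    (h₀ : ‖p₀ - (Real.sqrt 2)⁻¹ • (q₀ + q₁)‖ ≤ 3 / 2 * e)
    (h₁ : ‖p₁ - (Real.sqrt 2)⁻¹ • (q₀ - q₁)‖ ≤ 3 / 2 * e) :
    |inner ℝ p₀ p₁| ≤ 5 * e := by
  obtain ⟨hr0, hr1, hr2⟩ := sqrt_two_inv_bounds
  set r := (Real.sqrt 2)⁻¹
  set s₀ := p₀ - r • (q₀ + q₁)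
  set s₁ := p₁ - r • (q₀ - q₁)
  -- The exact Hadamard images have inner product (‖q₀‖² − ‖q₁‖²)/2, since the cross terms cancel.
  -- The three terms are bounded by 7e², 2.13e and 1.5e, which sum to less than 5e when 0 < e ≤
  -- 1/20.
  have hdec : inner ℝ p₀ p₁ = 1 / 2 * (‖q₀‖ ^ 2 - ‖q₁‖ ^ 2) + inner ℝ s₀ (r • (q₀ - q₁))
      + inner ℝ p₀ s₁ := by
    have e1 : inner ℝ p₀ p₁ = inner ℝ p₀ s₁ + inner ℝ p₀ (r • (q₀ - q₁)) := by
      rw [← inner_add_right, sub_add_cancel]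
    have e2 : inner ℝ p₀ (r • (q₀ - q₁)) = inner ℝ s₀ (r • (q₀ - q₁))
        + inner ℝ (r • (q₀ + q₁)) (r • (q₀ - q₁)) := by
      rw [← inner_add_left, sub_add_cancel]
    have e3 : inner ℝ (r • (q₀ + q₁)) (r • (q₀ - q₁)) = 1 / 2 * (‖q₀‖ ^ 2 - ‖q₁‖ ^ 2) := by
      rw [real_inner_smul_left, real_inner_smul_right, inner_add_left, inner_sub_right,
        inner_sub_right, real_inner_self_eq_norm_sq, real_inner_self_eq_norm_sq,
        real_inner_comm q₀ q₁, ← hr2]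
      ring
    rw [e1, e2, e3]; ring
  have b1 : |inner ℝ s₀ (r • (q₀ - q₁))| ≤ 3 / 2 * e * (71 / 100 * 2) := by
    refine (abs_real_inner_le_norm _ _).trans (mul_le_mul h₀ ?_ (norm_nonneg _) (by positivity))
    rw [norm_smul, Real.norm_of_nonneg (by linarith)]
    exact mul_le_mul hr1 ((norm_sub_le _ _).trans (by linarith)) (norm_nonneg _) (by norm_num)
  have b2 : |inner ℝ p₀ s₁| ≤ 1 * (3 / 2 * e) :=
    (abs_real_inner_le_norm _ _).trans (mul_le_mul hp₀ h₁ (norm_nonneg _) zero_le_one)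
  have b3 : |1 / 2 * (‖q₀‖ ^ 2 - ‖q₁‖ ^ 2)| ≤ 7 * e ^ 2 := by
    rw [abs_le]
    constructor <;> nlinarith [norm_nonneg q₀, norm_nonneg q₁]
  rw [hdec]
  refine (abs_add_le _ _).trans ?_
  have := abs_add_le (1 / 2 * (‖q₀‖ ^ 2 - ‖q₁‖ ^ 2)) (inner ℝ s₀ (r • (q₀ - q₁)))
  nlinarith

/-- Families of vectors, each concentrated on one register, which almost satisfy the relations
of an optimal strategy are concentrated on the same register. -/
theorem exists_common_register {n : ℕ} {p₀ p₁ q₀ q₁ : Fin n → V} {e : ℝ}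
    (he0 : 0 ≤ e) (he : e ≤ 1 / 20)
    (hp₀ : ∑ k, ‖p₀ k‖ ^ 2 ≤ 1) (hp₁ : ∑ k, ‖p₁ k‖ ^ 2 ≤ 1)
    (hq₀ : ∑ k, ‖q₀ k‖ ^ 2 ≤ 1) (hq₁ : ∑ k, ‖q₁ k‖ ^ 2 ≤ 1)
    (hp₀' : ∃ k, 1 - 14 * e ^ 2 ≤ ‖p₀ k‖ ^ 2) (hp₁' : ∃ k, 1 - 14 * e ^ 2 ≤ ‖p₁ k‖ ^ 2)
    (hq₀' : ∃ k, 1 - 14 * e ^ 2 ≤ ‖q₀ k‖ ^ 2) (hq₁' : ∃ k, 1 - 14 * e ^ 2 ≤ ‖q₁ k‖ ^ 2)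
    (hdef : ∀ k, ‖p₀ k - (Real.sqrt 2)⁻¹ • (q₀ k + q₁ k)‖ ^ 2
      + ‖p₁ k - (Real.sqrt 2)⁻¹ • (q₀ k - q₁ k)‖ ^ 2 ≤ e ^ 2) :
    ∃ k, 1 - 14 * e ^ 2 ≤ ‖p₀ k‖ ^ 2 ∧ 1 - 14 * e ^ 2 ≤ ‖p₁ k‖ ^ 2 ∧
      1 - 14 * e ^ 2 ≤ ‖q₀ k‖ ^ 2 ∧ 1 - 14 * e ^ 2 ≤ ‖q₁ k‖ ^ 2 ∧
      |inner ℝ (p₀ k) (p₁ k)| ≤ 5 * e ∧ |inner ℝ (q₀ k) (q₁ k)| ≤ 5 * e := by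
  obtain ⟨hr0, hr1, hr2⟩ := sqrt_two_inv_bounds
  set r := (Real.sqrt 2)⁻¹
  obtain ⟨i₀, hi₀⟩ := hp₀'
  obtain ⟨i₁, hi₁⟩ := hp₁'
  obtain ⟨k, hk₀⟩ := hq₀'
  obtain ⟨j, hj⟩ := hq₁'
  have hlarge : ∀ {x : ℝ}, 0 ≤ x → 1 - 14 * e ^ 2 ≤ x ^ 2 → 1 - e ≤ x := fun hx h => by
    nlinarith
  have d₀ : ∀ k, ‖p₀ k - r • (q₀ k + q₁ k)‖ ≤ e := fun k =>
    (sq_le_sq₀ (norm_nonneg _) he0).mp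
      ((le_add_of_nonneg_right (sq_nonneg _)).trans (hdef k))
  have d₁ : ∀ k, ‖p₁ k - r • (q₀ k - q₁ k)‖ ≤ e := fun k =>
    (sq_le_sq₀ (norm_nonneg _) he0).mp
      ((le_add_of_nonneg_left (sq_nonneg _)).trans (hdef k))
  have hrn : ∀ v : V, ‖r • v‖ = r * ‖v‖ := fun v => by
    rw [norm_smul, Real.norm_of_nonneg (by linarith)]
  have hup₀ : ∀ k, ‖p₀ k‖ ≤ r * (‖q₀ k‖ + ‖q₁ k‖) + e := fun k => by
    have h1 := norm_le_norm_add_norm_sub' (p₀ k) (r • (q₀ k + q₁ k))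
    rw [hrn] at h1
    have h2 := mul_le_mul_of_nonneg_left (norm_add_le (q₀ k) (q₁ k)) (by linarith : 0 ≤ r)
    linarith [d₀ k]
  have hup₁ : ∀ k, ‖p₁ k‖ ≤ r * (‖q₀ k‖ + ‖q₁ k‖) + e := fun k => by
    have h1 := norm_le_norm_add_norm_sub' (p₁ k) (r • (q₀ k - q₁ k))
    rw [hrn] at h1
    have h2 := mul_le_mul_of_nonneg_left (norm_sub_le (q₀ k) (q₁ k)) (by linarith : 0 ≤ r)
    linarith [d₁ k]
  have hn₀ := norm_le_one_of_sum hq₀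
  have hn₁ := norm_le_one_of_sum hq₁
  -- If q₀ and q₁ had different dominant registers, then ‖p₀ k‖ would be about 1/√2: too large for a
  -- register that is not dominant for p₀, too small for one that is.
  have hjk : j = k := by
    by_contra hne
    have hsmall : ‖q₁ k‖ ≤ 4 * e := not_lt.mp fun h => hne (eq_of_norm_sq_large hq₁ hj he0 h).symm
    have hk1 := hlarge (norm_nonneg _) hk₀
    have hlow : r * (‖q₀ k‖ - ‖q₁ k‖) - e ≤ ‖p₀ k‖ := by
      have h1 := norm_le_norm_add_norm_sub (p₀ k) (r • (q₀ k + q₁ k))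
      rw [hrn] at h1
      have h3 : ‖q₀ k‖ - ‖q₁ k‖ ≤ ‖q₀ k + q₁ k‖ := by
        have := norm_sub_norm_le (q₀ k) (-q₁ k)
        rwa [norm_neg, sub_neg_eq_add] at this
      have h2 := mul_le_mul_of_nonneg_left h3 (by linarith : 0 ≤ r)
      linarith [d₀ k]
    have hki : k = i₀ := eq_of_norm_sq_large hp₀ hi₀ he0 (by nlinarith)
    rw [← hki] at hi₀
    have h4 := hlarge (norm_nonneg _) hi₀
    nlinarith [hup₀ k, hn₀ k]
  rw [hjk] at hj
  -- Away from `k` both of Bob's vectors are at most 4e, so Alice's cannot reach the norm 1 − e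
  -- required at a dominant register.
  have hoff : ∀ i, i ≠ k → r * (‖q₀ i‖ + ‖q₁ i‖) + e < 1 - e := fun i hi => by
    have h0 : ‖q₀ i‖ ≤ 4 * e := not_lt.mp fun h => hi (eq_of_norm_sq_large hq₀ hk₀ he0 h)
    have h1 : ‖q₁ i‖ ≤ 4 * e := not_lt.mp fun h => hi (eq_of_norm_sq_large hq₁ hj he0 h)
    nlinarith [norm_nonneg (q₀ i), norm_nonneg (q₁ i)]
  have hi₀k : i₀ = k := by
    by_contra hne
    linarith [hoff i₀ hne, hup₀ i₀, hlarge (norm_nonneg _) hi₀]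
  have hi₁k : i₁ = k := by
    by_contra hne
    linarith [hoff i₁ hne, hup₁ i₁, hlarge (norm_nonneg _) hi₁]
  rw [hi₀k] at hi₀
  rw [hi₁k] at hi₁
  have hm₀ := norm_le_one_of_sum hp₀ k
  have hm₁ := norm_le_one_of_sum hp₁ k
  refine ⟨k, hi₀, hi₁, hk₀, hj, ?_, ?_⟩
  · exact abs_inner_le_of_hadamard he0 he hm₀ (hn₀ k) (hn₁ k) hk₀ hj
      ((d₀ k).trans (by linarith)) ((d₁ k).trans (by linarith))
  -- The Hadamard rotation is an involution, so the roles of p and q can be exchanged. The new error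
  -- is at most 2re ≤ 1.42e, which is why the lemma allows 3/2 · e.
  · have hc : 2 * r * r = 1 := by linear_combination 2 * hr2
    have c₀ : q₀ k - r • (p₀ k + p₁ k) = -(r • ((p₀ k - r • (q₀ k + q₁ k))
        + (p₁ k - r • (q₀ k - q₁ k)))) := by
      linear_combination (norm := module) (-hc) • q₀ k
    have c₁ : q₁ k - r • (p₀ k - p₁ k) = -(r • ((p₀ k - r • (q₀ k + q₁ k))
        - (p₁ k - r • (q₀ k - q₁ k)))) := by
      linear_combination (norm := module) (-hc) • q₁ k
    refine abs_inner_le_of_hadamard he0 he (hn₀ k) hm₀ hm₁ hi₀ hi₁ ?_ ?_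
    · rw [c₀, norm_neg, hrn]
      have := mul_le_mul_of_nonneg_left ((norm_add_le (p₀ k - r • (q₀ k + q₁ k))
        (p₁ k - r • (q₀ k - q₁ k)))) (by linarith : 0 ≤ r)
      nlinarith [d₀ k, d₁ k]
    · rw [c₁, norm_neg, hrn]
      have := mul_le_mul_of_nonneg_left ((norm_sub_le (p₀ k - r • (q₀ k + q₁ k))
        (p₁ k - r • (q₀ k - q₁ k)))) (by linarith : 0 ≤ r)
      nlinarith [d₀ k, d₁ k]

/-- Two almost orthonormal vectors are close to orthonormal ones. -/
theorem exists_orthonormal_pair {v w : V} {e : ℝ} (he0 : 0 ≤ e) (he : e ≤ 1 / 20)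
    (hv1 : ‖v‖ ≤ 1) (hw1 : ‖w‖ ≤ 1) (hv : 1 - 14 * e ^ 2 ≤ ‖v‖ ^ 2)
    (hw : 1 - 14 * e ^ 2 ≤ ‖w‖ ^ 2) (hvw : |inner ℝ v w| ≤ 5 * e) :
    ∃ a b : V, ‖a‖ = 1 ∧ ‖b‖ = 1 ∧ inner ℝ a b = 0 ∧
      1 - 50 * e ^ 2 ≤ inner ℝ a v ∧ 1 - 50 * e ^ 2 ≤ inner ℝ b w := by
  have hv0 : v ≠ 0 := fun h => by rw [h, norm_zero] at hv; nlinarith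
  have hvn : 0 < ‖v‖ := norm_pos_iff.mpr hv0
  set a := ‖v‖⁻¹ • v with ha
  have ha1 : ‖a‖ = 1 := norm_smul_inv_norm hv0
  have hav : inner ℝ a v = ‖v‖ := by
    rw [ha, real_inner_smul_left, real_inner_self_eq_norm_sq]
    field_simp
  set c := inner ℝ a w with hc
  have hcv : ‖v‖ * c = inner ℝ v w := by
    rw [hc, ha, real_inner_smul_left]
    field_simp
  -- From ‖v‖²c² ≤ 25e² and ‖v‖² ≥ 9/10.
  have hc2 : c ^ 2 ≤ 30 * e ^ 2 := by
    have h1 : (inner ℝ v w) ^ 2 ≤ (5 * e) ^ 2 := sq_le_sq' (abs_le.mp hvw).1 (abs_le.mp hvw).2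
    rw [← hcv, mul_pow] at h1
    have h2 : 9 / 10 ≤ ‖v‖ ^ 2 := by nlinarith
    nlinarith [mul_le_mul_of_nonneg_right h2 (sq_nonneg c)]
  set u := w - c • a with hu
  have hau : inner ℝ a u = 0 := by
    rw [hu, inner_sub_right, real_inner_smul_right, real_inner_self_eq_norm_sq, ha1, ← hc]
    ring
  have huw : inner ℝ u w = ‖w‖ ^ 2 - c ^ 2 := by
    rw [hu, inner_sub_left, real_inner_smul_left, ← hc, real_inner_self_eq_norm_sq]
    ring
  have huu : ‖u‖ ^ 2 = ‖w‖ ^ 2 - c ^ 2 := by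
    rw [← real_inner_self_eq_norm_sq]
    conv_lhs => rw [hu, inner_sub_right, real_inner_smul_right, ← hu, real_inner_comm a u, hau, huw]
    ring
  have hu0 : u ≠ 0 := fun h => by rw [h, norm_zero] at huu; nlinarith
  have hun : 0 < ‖u‖ := norm_pos_iff.mpr hu0
  have hu1 : ‖u‖ ≤ 1 := by nlinarith [sq_nonneg c, norm_nonneg w]
  refine ⟨a, ‖u‖⁻¹ • u, ha1, norm_smul_inv_norm hu0, ?_, ?_, ?_⟩
  · rw [real_inner_smul_right, hau, mul_zero]
  · rw [hav]
    nlinarith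
  · have : inner ℝ (‖u‖⁻¹ • u) w = ‖u‖ := by
      rw [real_inner_smul_left, huw, ← huu]
      field_simp
    rw [this]
    -- Since ‖u‖ ≤ 1, the norm is at least its square ‖w‖² − c² ≥ 1 − 44e².
    nlinarith

end Geometry

/-! ### Rigidity -/

section Rigidity

variable {n : ℕ}

theorem norm_blochVec_observable_le_one (E : POVM (Fin n → Fin 2)) (k : Fin n) :
    ‖blochVec E.observable k‖ ≤ 1 :=
  norm_le_one_of_sum (sum_norm_blochVec_sq_le E) k

/-- Orthonormal Bloch vectors, at a common register, that are close to those of the observables of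
each player. -/
theorem exists_register_orthonormal (hn : 1 ≤ n) (S : Strategy n) {e : ℝ} (he0 : 0 ≤ e)
    (he : e ≤ 1 / 20) (hw : ∀ D x, 1 - e ^ 2 ≤ ∑ k, ‖blochVec (S.obs D x) k‖ ^ 2)
    (hd : ∀ k, blochDefect S k ≤ e ^ 2) :
    ∃ k, ∀ D, ∃ a b : EuclideanSpace ℝ (Fin 3), ‖a‖ = 1 ∧ ‖b‖ = 1 ∧ inner ℝ a b = 0 ∧
      1 - 50 * e ^ 2 ≤ inner ℝ a (blochVec (S.obs D 0) k) ∧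
      1 - 50 * e ^ 2 ≤ inner ℝ b (blochVec (S.obs D 1) k) := by
  have hle : ∀ D x, ∑ k, ‖blochVec (S.obs D x) k‖ ^ 2 ≤ 1 := fun D x =>
    sum_norm_blochVec_sq_le (S D x)
  have hdom : ∀ D x, ∃ k, 1 - 14 * e ^ 2 ≤ ‖blochVec (S.obs D x) k‖ ^ 2 := fun D x => by
    obtain ⟨k, hk⟩ := exists_dominant_register hn (S D x)
    refine ⟨k, le_trans ?_ hk⟩
    have := hw D x
    rw [Strategy.obs] at this
    linarith
  obtain ⟨k, hp₀, hp₁, hq₀, hq₁, hp, hq⟩ := exists_common_register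
    (p₀ := blochVec (S.obs .alice 0)) (p₁ := blochVec (S.obs .alice 1))
    (q₀ := blochVecT (S.obs .bob 0)) (q₁ := blochVecT (S.obs .bob 1)) he0 he
    (hle _ _) (hle _ _) (by simpa only [norm_blochVecT] using hle _ _)
    (by simpa only [norm_blochVecT] using hle _ _) (hdom _ _) (hdom _ _)
    (by simpa only [norm_blochVecT] using hdom _ _)
    (by simpa only [norm_blochVecT] using hdom _ _) hd
  rw [norm_blochVecT] at hq₀ hq₁
  rw [inner_blochVecT] at hq
  refine ⟨k, fun D => ?_⟩
  have h1 : ∀ x, ‖blochVec (S.obs D x) k‖ ≤ 1 := fun x => norm_blochVec_observable_le_one (S D x) k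
  cases D with
  | alice => exact exists_orthonormal_pair he0 he (h1 0) (h1 1) hp₀ hp₁ hp
  | bob => exact exists_orthonormal_pair he0 he (h1 0) (h1 1) hq₀ hq₁ hq

/-- Removes the smallness of `e`. For e ≤ 1/20 the distance is at most √(100e²) = 10e. For larger e
the bound 40e exceeds 2, the value at c = −1, and any register and any orthonormal pair will do. -/
theorem exists_register_orthonormal_or_large (hn : 1 ≤ n) (S : Strategy n) {e : ℝ} (he0 : 0 ≤ e)
    (hw : ∀ D x, 1 - e ^ 2 ≤ ∑ k, ‖blochVec (S.obs D x) k‖ ^ 2)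
    (hd : ∀ k, blochDefect S k ≤ e ^ 2) :
    ∃ k, ∃ c : ℝ, Real.sqrt (2 - 2 * c) ≤ 40 * e ∧
      ∀ D, ∃ a b : EuclideanSpace ℝ (Fin 3), ‖a‖ = 1 ∧ ‖b‖ = 1 ∧ inner ℝ a b = 0 ∧
        c ≤ inner ℝ a (blochVec (S.obs D 0) k) ∧ c ≤ inner ℝ b (blochVec (S.obs D 1) k) := by
  by_cases he : e ≤ 1 / 20
  · obtain ⟨k, hk⟩ := exists_register_orthonormal hn S he0 he hw hd
    refine ⟨k, 1 - 50 * e ^ 2, ?_, hk⟩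
    exact Real.sqrt_le_iff.mpr ⟨by positivity, by nlinarith⟩
  · refine ⟨⟨0, hn⟩, -1, Real.sqrt_le_iff.mpr ⟨by positivity, by nlinarith⟩, fun D => ?_⟩
    have ha : ‖(EuclideanSpace.single 0 1 : EuclideanSpace ℝ (Fin 3))‖ = 1 := by simp
    obtain ⟨b, hb, hab⟩ := exists_orthogonal_unit ha
    have hlow : ∀ u : EuclideanSpace ℝ (Fin 3), ‖u‖ = 1 → ∀ x,
        -1 ≤ inner ℝ u (blochVec (S.obs D x) ⟨0, hn⟩) := fun u hu x => by
      have h1 := (abs_le.mp (abs_real_inner_le_norm u (blochVec (S.obs D x) ⟨0, hn⟩))).1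
      have h2 : ‖blochVec (S.obs D x) ⟨0, hn⟩‖ ≤ 1 := norm_blochVec_observable_le_one (S D x) _
      rw [hu, one_mul] at h1
      linarith
    exact ⟨_, b, ha, hb, hab, hlow _ ha 0, hlow b hb 1⟩

theorem sqrt_error_le {ρ₀ ρ ε : ℝ} (hρ₀ : 0 < ρ₀) (hρ : ρ₀ ≤ ρ) (hρ1 : ρ < 1) :
    Real.sqrt (8 * (1 / (1 - ρ)) * ε / ρ)
      ≤ Real.sqrt (8 / ρ₀) * (1 / (1 - ρ) * Real.sqrt ε) := by
  have hρ0 : 0 < ρ := hρ₀.trans_le hρ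
  have h1 : 0 < 1 - ρ := by linarith
  have hγ : 1 ≤ 1 / (1 - ρ) := by rw [le_div_iff₀ h1]; linarith
  have h8 : 8 / ρ ≤ 8 / ρ₀ := by gcongr
  rw [show 8 * (1 / (1 - ρ)) * ε / ρ = 8 / ρ * (1 / (1 - ρ) * ε) by ring,
    Real.sqrt_mul (by positivity), Real.sqrt_mul (by positivity)]
  gcongr
  -- Here γ ≥ 1 gives √γ ≤ γ.
  exact Real.sqrt_le_iff.mpr ⟨by positivity, by nlinarith⟩

end Rigidity

end NoisyCHSH

end

/-! ### The main theorem -/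

open NoisyCHSH in
theorem mainTheorem2 (ρ₀ : ℝ) (hρ₀ : 0 < ρ₀) :
    ∃ C : ℝ, 0 < C ∧
      ∀ (ρ : ℝ) (hρ : 0 < ρ) (hρ1 : ρ < 1), ρ₀ ≤ ρ →
      ∀ (n : ℕ), 1 ≤ n →
      ∀ (S : Strategy n) (t : ℕ) (p δ εv : ℝ), 1 ≤ t → 0 < p →
        δ = Real.sqrt (2 * Real.log (2 / p) / t) →
        p ≤ S.passProb (noisyEPR n ρ hρ.le hρ1.le) t δ →
        0 ≤ εv →
        2 * Real.sqrt 2 * ρ - εv ≤ S.violation (noisyEPR n ρ hρ.le hρ1.le) →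
        ∀ (γ ε : ℝ), γ = 1 / (1 - ρ) → ε = εv + 9 * δ ^ 2 →
        ∃ k : Fin n,
          (∀ (D : Player) (j : Fin 2), ∃ T : Matrix (Fin 2) (Fin 2) ℂ,
            IsTracelessObservable T ∧
            normF (S.obs D j - onRegister k T) ≤ C * (γ * Real.sqrt ε)) ∧
          (∃ UA ∈ Matrix.unitaryGroup (Fin 2) ℂ, ∃ UB ∈ Matrix.unitaryGroup (Fin 2) ℂ,
            normF (onRegister k UA * S.obs .alice 0 * (onRegister k UA).conjTranspose
              - onRegister k pauliZ) ≤ C * (γ * Real.sqrt ε) ∧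
            normF (onRegister k UA * S.obs .alice 1 * (onRegister k UA).conjTranspose
              - onRegister k pauliX) ≤ C * (γ * Real.sqrt ε) ∧
            normF (onRegister k UB * S.obs .bob 0 * (onRegister k UB).conjTranspose
              - onRegister k pauliZ) ≤ C * (γ * Real.sqrt ε) ∧
            normF (onRegister k UB * S.obs .bob 1 * (onRegister k UB).conjTranspose
              - onRegister k pauliX) ≤ C * (γ * Real.sqrt ε)) := by
  refine ⟨40 * Real.sqrt (8 / ρ₀), by positivity, ?_⟩
  intro ρ hρ hρ1 hρ₀ρ n hn S t p δ εv ht hp hδ hpass hεv hviol γ ε hγ hε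
  subst hγ hε
  set ε := εv + 9 * δ ^ 2 with hε
  have h1ρ : 0 < 1 - ρ := by linarith
  have hε0 : 0 ≤ ε := by positivity
  -- Chosen so that ρ(1 − ρ)η = 8ε. This dominates the total weight on the identity string, at most
  -- 4 · 16δ² = 64δ² ≤ 8 · 9δ², plus √2·εv ≤ 8εv. The geometric parameter e is then √η.
  set η := 8 * (1 / (1 - ρ)) * ε / ρ with hη
  have hη0 : 0 ≤ η := by positivity
  have hzero := pauliCoeff_obs_zero_sq_le hρ.le hρ1.le S ht hp hδ hpass
  have hsmall : totalWeight S 0 + Real.sqrt 2 * εv ≤ ρ * (1 - ρ) * η := by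
    have h2 : Real.sqrt 2 ≤ 2 := Real.sqrt_le_iff.mpr (by norm_num)
    have h3 : ρ * (1 - ρ) * η = 8 * ε := by rw [hη]; field_simp
    rw [h3, totalWeight, hε]
    nlinarith [hzero .alice 0, hzero .alice 1, hzero .bob 0, hzero .bob 1, sq_nonneg δ]
  obtain ⟨hw, hd⟩ := degreeOne_of_violation hρ.le hρ1.le S hρ hρ1 hsmall hη0 hviol
  have hsq : Real.sqrt η ^ 2 = η := Real.sq_sqrt hη0
  obtain ⟨k, c, hc, hk⟩ := exists_register_orthonormal_or_large hn S (Real.sqrt_nonneg η)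
    (by rwa [hsq]) (by rwa [hsq])
  have hbound : Real.sqrt (2 - 2 * c)
      ≤ 40 * Real.sqrt (8 / ρ₀) * (1 / (1 - ρ) * Real.sqrt ε) := by
    have := sqrt_error_le (ε := ε) hρ₀ hρ₀ρ hρ1
    linarith
  refine ⟨k, fun D j => ?_, ?_⟩
  · obtain ⟨a, b, ha, hb, -, hca, hcb⟩ := hk D
    fin_cases j
    · exact ⟨bloch a, isTracelessObservable_bloch ha,
        (normF_observable_sub_le (S D 0) k ha hca).trans hbound⟩
    · exact ⟨bloch b, isTracelessObservable_bloch hb,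
        (normF_observable_sub_le (S D 1) k hb hcb).trans hbound⟩
  · obtain ⟨a, b, ha, hb, hab, hca, hcb⟩ := hk .alice
    obtain ⟨UA, hUA, hA0, hA1⟩ := exists_unitary_register (S .alice 0) (S .alice 1) k ha hb hab
      hca hcb
    obtain ⟨a', b', ha', hb', hab', hca', hcb'⟩ := hk .bob
    obtain ⟨UB, hUB, hB0, hB1⟩ := exists_unitary_register (S .bob 0) (S .bob 1) k ha' hb' hab'
      hca' hcb'
    exact ⟨UA, hUA, UB, hUB, hA0.trans hbound, hA1.trans hbound, hB0.trans hbound,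
      hB1.trans hbound⟩
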